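/- Let $\Gamma$ be an infinite group with a finite generating set $S$, and let $1<p<\infty$ be real. Consider the Cayley graph of $\Gamma$ with respect to $S$: $x\neq y$ are neighbours, $x\sim y$, iff $x=ys^{\pm1}$ for some $s\in S$. For $f:\Gamma\to\mathbb{R}$ put $$I_p(f)=\sum_{x\in\Gamma}\sum_{y\sim x}|f(y)-f(x)|^p,\qquad \Delta_pf(x)=\sum_{y\sim x}|f(y)-f(x)|^{p-2}(f(y)-f(x)),$$ where a summand of $\Delta_p f(x)$ with $f(y)=f(x)$ is read as $0$. * $D_p(\Gamma)=\{f:\Gamma\to\mathbb{R} \mid I_p(f)<\infty\}$, with the norm $\|f\|_{D_p}=(I_p(f)+|f(e)|^p)^{1/p}$, where $e$ is the identity element of $\Gamma$; $D_p(\Gamma)/\mathbb{R}$ is its quotient by the constant functions, with the norm $\|[f]\|=I_p(f)^{1/p}$. * $\bar H^1_{(p)}(\Gamma)=D_p(\Gamma)/\overline{\ell^p(\Gamma)\oplus\mathbb{R}}$, the closure being taken in $D_p(\Gamma)$. * $HD_p(\Gamma)=\{f\in D_p(\Gamma)\mid\Delta_pf=0 \text{ on } \Gamma\}$, and $BHD_p(\Gamma)$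 is the set of bounded functions in $HD_p(\Gamma)$. * $BD_p(\Gamma)$ is the algebra of bounded functions in $D_p(\Gamma)$ under pointwise operations, and $Sp(BD_p(\Gamma))$ is the set of its characters, i.e. nonzero algebra homomorphisms $BD_p(\Gamma)\to\mathbb{C}$. The $p$-harmonic boundary $\partial_p(\Gamma)$ is the set of those characters $\tau$ that are not an evaluation $f\mapsto f(x)$ at a point $x\in\Gamma$ and that satisfy $\tau(f)=0$ for every $f\in BD_p(\Gamma)$ in the $D_p$-closure of the finitely supported functions. * A translation invariant linear functional (TILF) on $D_p(\Gamma)/\mathbb{R}$ is a linear map $T:D_p(\Gamma)/\mathbb{R}\to\mathbb{R}$, not necessarily continuous, with $T([f_x])=T([f])$ for all $f\in D_p(\Gamma)$ and $x\in\Gamma$, where $f_x(g)=f(gx^{-1})$. **Theorem.** The following are equivalent: 1. $\bar H^1_{(p)}(\Gamma)=0$; 2. $\partial_p(\Gamma)=\emptyset$ or $\partial_p(\Gamma)$ has exactly one element; 3. $HD_p(\Gamma)=\mathbb{R}$, i.e. $HD_p(\Gamma)$ consists exactly of the constant functions; 4. $BHD_p(\Gamma)=\mathbb{R}$, i.e.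 $BHD_p(\Gamma)$ consists exactly of the constant functions; 5. the only continuous TILF on $D_p(\Gamma)/\mathbb{R}$ is zero. If moreover $\Gamma$ is nonamenable (there is no left invariant finitely additive probability measure on the set of all subsets of $\Gamma$), then these are also equivalent to: 6. zero is the only TILF on $D_p(\Gamma)/\mathbb{R}$. -/

import Mathlib

open scoped ENNReal Pointwise

noncomputable section

namespace PHarm

section Graph

variable {V : Type*} (G : SimpleGraph V) [G.LocallyFinite] (p : ℝ)

/-- The `p`-th power of the gradient, `|Df(x)|^p = ∑_{y ∼ x} |f(y) - f(x)|^p`. -/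
def gradPow (f : V → ℝ) (x : V) : ℝ≥0∞ :=
  ∑ y ∈ G.neighborFinset x, ENNReal.ofReal (|f y - f x| ^ p)

/-- The `p`-Dirichlet sum `I_p(f, V) = ∑_x |Df(x)|^p`, with values in `[0, ∞]`. -/
def dirichletSum (f : V → ℝ) : ℝ≥0∞ := ∑' x, gradPow G p f x

/-- The `p`-Laplacian `Δ_p f(x) = ∑_{y ∼ x} |f(y) - f(x)|^{p-2} (f(y) - f(x))`.
The summands with `f y = f x` are `0`, also when `p < 2`. -/
def pLaplacian (f : V → ℝ) (x : V) : ℝ :=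
  ∑ y ∈ G.neighborFinset x, |f y - f x| ^ (p - 2) * (f y - f x)

/-- `f` is `p`-harmonic on the whole vertex set. -/
def IsPHarmonic (f : V → ℝ) : Prop := ∀ x, pLaplacian G p f x = 0

/-- `f` is a bounded function. -/
def IsBdd (f : V → ℝ) : Prop := ∃ C : ℝ, ∀ x, |f x| ≤ C

/-- The set `HD_p(G)` of `p`-harmonic functions that are `p`-Dirichlet finite. -/
def HD : Set (V → ℝ) := {f | dirichletSum G p f < ∞ ∧ IsPHarmonic G p f}

/-- The set `BHD_p(G)` of bounded functions in `HD_p(G)`. -/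
def BHD : Set (V → ℝ) := {f | f ∈ HD G p ∧ IsBdd f}

/-- The set of constant functions on `V`, identified with `ℝ`. -/
def constFun (V : Type*) : Set (V → ℝ) := Set.range fun c : ℝ => fun _ : V => c

variable {G p}

lemma add_rpow_bound (hp : 0 ≤ p) {u v : ℝ} (hu : 0 ≤ u) (hv : 0 ≤ v) :
    (u + v) ^ p ≤ 2 ^ p * (u ^ p + v ^ p) := by
  have h1 : (u + v) ^ p ≤ (2 * max u v) ^ p := by
    apply Real.rpow_le_rpow (by positivity) _ hp
    have := le_max_left u v
    have := le_max_right u v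
    linarith
  rw [Real.mul_rpow (by norm_num) (le_max_of_le_left hu)] at h1
  refine h1.trans ?_
  have hu' : 0 ≤ u ^ p := Real.rpow_nonneg hu p
  have hv' : 0 ≤ v ^ p := Real.rpow_nonneg hv p
  gcongr
  rcases max_choice u v with h | h <;> rw [h] <;> linarith

lemma dirichletSum_lt_top_of_le (hp : 0 ≤ p) {f g k : V → ℝ} {a b : ℝ} (ha : 0 ≤ a) (hb : 0 ≤ b)
    (hk : ∀ x y, |k y - k x| ≤ a * |f y - f x| + b * |g y - g x|)
    (hf : dirichletSum G p f < ∞) (hg : dirichletSum G p g < ∞) : dirichletSum G p k < ∞ := by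
  have key : ∀ x, gradPow G p k x ≤
      ENNReal.ofReal (2 ^ p * a ^ p) * gradPow G p f x +
        ENNReal.ofReal (2 ^ p * b ^ p) * gradPow G p g x := by
    intro x
    unfold gradPow
    rw [Finset.mul_sum, Finset.mul_sum, ← Finset.sum_add_distrib]
    refine Finset.sum_le_sum fun y _ => ?_
    rw [← ENNReal.ofReal_mul (by positivity), ← ENNReal.ofReal_mul (by positivity),
      ← ENNReal.ofReal_add (by positivity) (by positivity)]
    apply ENNReal.ofReal_le_ofReal
    calc |k y - k x| ^ p ≤ (a * |f y - f x| + b * |g y - g x|) ^ p :=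
          Real.rpow_le_rpow (abs_nonneg _) (hk x y) hp
      _ ≤ 2 ^ p * ((a * |f y - f x|) ^ p + (b * |g y - g x|) ^ p) :=
          add_rpow_bound hp (by positivity) (by positivity)
      _ = _ := by
          rw [Real.mul_rpow ha (abs_nonneg _), Real.mul_rpow hb (abs_nonneg _)]; ring
  calc dirichletSum G p k ≤ ∑' x, (ENNReal.ofReal (2 ^ p * a ^ p) * gradPow G p f x +
        ENNReal.ofReal (2 ^ p * b ^ p) * gradPow G p g x) := ENNReal.tsum_le_tsum key
    _ = ENNReal.ofReal (2 ^ p * a ^ p) * dirichletSum G p f +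
        ENNReal.ofReal (2 ^ p * b ^ p) * dirichletSum G p g := by
          rw [ENNReal.tsum_add, ENNReal.tsum_mul_left, ENNReal.tsum_mul_left]; rfl
    _ < ∞ := ENNReal.add_lt_top.2 ⟨ENNReal.mul_lt_top ENNReal.ofReal_lt_top hf,
        ENNReal.mul_lt_top ENNReal.ofReal_lt_top hg⟩

lemma dirichletSum_const (hp : p ≠ 0) (c : ℝ) : dirichletSum G p (fun _ => c) = 0 := by
  simp [dirichletSum, gradPow, Real.zero_rpow hp]

lemma dirichletSum_add_const (f : V → ℝ) (c : ℝ) :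
    dirichletSum G p (fun x => f x + c) = dirichletSum G p f := by
  simp [dirichletSum, gradPow]

variable (G p) [hp : Fact (1 < p)]

/-- The linear space of `p`-Dirichlet finite functions. -/
def dirichletSubmodule : Submodule ℝ (V → ℝ) where
  carrier := {f | dirichletSum G p f < ∞}
  add_mem' {f g} hf hg := by
    refine dirichletSum_lt_top_of_le (a := 1) (b := 1) (by linarith [hp.out]) zero_le_one
      zero_le_one (fun x y => ?_) hf hg
    simp only [Pi.add_apply, one_mul]
    exact (congrArg abs (by ring)).le.trans (abs_add_le _ _)
  zero_mem' := by
    change dirichletSum G p (fun _ => (0 : ℝ)) < ∞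
    rw [dirichletSum_const (by linarith [hp.out])]; exact ENNReal.zero_lt_top
  smul_mem' c f hf := by
    refine dirichletSum_lt_top_of_le (a := |c|) (b := 0) (by linarith [hp.out]) (abs_nonneg c)
      le_rfl (fun x y => ?_) hf hf
    simp only [Pi.smul_apply, smul_eq_mul, ← mul_sub, abs_mul]
    linarith

/-- The algebra `BD_p(G)` of bounded `p`-Dirichlet finite functions, under pointwise operations. -/
def BD : Subalgebra ℝ (V → ℝ) where
  carrier := {f | dirichletSum G p f < ∞ ∧ IsBdd f}
  add_mem' {f g} hf hg := by
    refine ⟨(dirichletSubmodule G p).add_mem hf.1 hg.1, ?_⟩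
    obtain ⟨A, hA⟩ := hf.2
    obtain ⟨B, hB⟩ := hg.2
    exact ⟨A + B, fun x => (abs_add_le _ _).trans (add_le_add (hA x) (hB x))⟩
  mul_mem' {f g} hf hg := by
    obtain ⟨A, hA⟩ := hf.2
    obtain ⟨B, hB⟩ := hg.2
    refine ⟨?_, A * B, fun x => ?_⟩
    · refine dirichletSum_lt_top_of_le (a := |B|) (b := |A|) (by linarith [hp.out]) (abs_nonneg _)
        (abs_nonneg _) (fun x y => ?_) hf.1 hg.1
      have e : (f * g) y - (f * g) x = g y * (f y - f x) + f x * (g y - g x) := by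
        simp only [Pi.mul_apply]; ring
      rw [e]
      refine (abs_add_le _ _).trans ?_
      rw [abs_mul, abs_mul]
      have h1 := (hB y).trans (le_abs_self B)
      have h2 := (hA x).trans (le_abs_self A)
      gcongr
    · rw [Pi.mul_apply, abs_mul]
      exact mul_le_mul (hA x) (hB x) (abs_nonneg _) ((abs_nonneg _).trans (hA x))
  algebraMap_mem' c := by
    refine ⟨?_, |c|, fun x => le_rfl⟩
    change dirichletSum G p (fun _ => c) < ∞
    rw [dirichletSum_const (by linarith [hp.out])]; exact ENNReal.zero_lt_top

/-- The space `D_p(G)` of `p`-Dirichlet finite functions on `G`, as a normed space with base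
vertex `o` (see the instance below). -/
def DirichletSpace (_o : V) : Type _ := dirichletSubmodule G p

namespace DirichletSpace

variable {G p} {o : V}

instance : AddCommGroup (DirichletSpace G p o) :=
  inferInstanceAs (AddCommGroup (dirichletSubmodule G p))

instance : Module ℝ (DirichletSpace G p o) :=
  inferInstanceAs (Module ℝ (dirichletSubmodule G p))

/-- The underlying function of an element of `D_p(G)`. -/
def toFun (f : DirichletSpace G p o) : V → ℝ := Subtype.val (p := (· ∈ dirichletSubmodule G p)) f

instance : CoeFun (DirichletSpace G p o) fun _ => V → ℝ := ⟨toFun⟩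

/-- The element of `D_p(G)` given by a `p`-Dirichlet finite function. -/
def mk (f : V → ℝ) (hf : dirichletSum G p f < ∞) : DirichletSpace G p o := ⟨f, hf⟩

@[ext] lemma ext {f g : DirichletSpace G p o} (h : ∀ x, f x = g x) : f = g :=
  Subtype.ext (funext h)

lemma dirichletSum_lt_top (f : DirichletSpace G p o) : dirichletSum G p f < ∞ :=
  Subtype.prop (p := (· ∈ dirichletSubmodule G p)) f

@[simp] lemma add_apply (f g : DirichletSpace G p o) (x : V) : (f + g) x = f x + g x := rfl
@[simp] lemma sub_apply (f g : DirichletSpace G p o) (x : V) : (f - g) x = f x - g x := rfl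
@[simp] lemma zero_apply (x : V) : (0 : DirichletSpace G p o) x = 0 := rfl
@[simp] lemma smul_apply (c : ℝ) (f : DirichletSpace G p o) (x : V) : (c • f) x = c * f x := rfl
@[simp] lemma mk_apply (f : V → ℝ) (hf : dirichletSum G p f < ∞) (x : V) :
    (mk f hf : DirichletSpace G p o) x = f x := rfl

/-- The norm `‖f‖_{D_p} = (I_p(f, V) + |f(o)|^p)^{1/p}`. -/
instance : Norm (DirichletSpace G p o) :=
  ⟨fun f => ((dirichletSum G p f).toReal + |f o| ^ p) ^ (1 / p)⟩

lemma norm_def (f : DirichletSpace G p o) :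
    ‖f‖ = ((dirichletSum G p f).toReal + |f o| ^ p) ^ (1 / p) := rfl

open Classical in
/-- The value at the base vertex together with all edge differences. -/
def coord (o : V) (f : V → ℝ) : Unit ⊕ ((_ : V) × V) → ℝ
  | .inl _ => f o
  | .inr e => if G.Adj e.1 e.2 then f e.2 - f e.1 else 0

lemma gradPow_eq_tsum (f : V → ℝ) (x : V) : gradPow G p f x =
    ∑' y, ENNReal.ofReal (|coord (G := G) o f (.inr ⟨x, y⟩)| ^ p) := by
  have hp0 : p ≠ 0 := by linarith [hp.out]
  rw [tsum_eq_sum (s := G.neighborFinset x)]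
  · refine Finset.sum_congr rfl fun y hy => ?_
    rw [SimpleGraph.mem_neighborFinset] at hy
    simp [coord, hy]
  · intro y hy
    rw [SimpleGraph.mem_neighborFinset] at hy
    simp [coord, hy, Real.zero_rpow hp0]

lemma dirichletSum_eq_tsum (f : V → ℝ) : dirichletSum G p f =
    ∑' e, ENNReal.ofReal (|coord (G := G) o f (.inr e)| ^ p) := by
  rw [ENNReal.tsum_sigma']
  exact tsum_congr fun x => gradPow_eq_tsum f x

lemma summable_coord (f : DirichletSpace G p o) :
    Summable fun i => |coord (G := G) o f i| ^ p := by
  have h := f.dirichletSum_lt_top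
  rw [dirichletSum_eq_tsum (o := o)] at h
  have h2 := ENNReal.summable_toReal h.ne
  simp only [ENNReal.toReal_ofReal (Real.rpow_nonneg (abs_nonneg _) _)] at h2
  exact (HasSum.sum (hasSum_fintype _) h2.hasSum).summable

lemma norm_eq_tsum (f : DirichletSpace G p o) :
    ‖f‖ = (∑' i, |coord (G := G) o f i| ^ p) ^ (1 / p) := by
  have h := summable_coord f
  rw [norm_def, Summable.tsum_sum (h.comp_injective Sum.inl_injective)
    (h.comp_injective Sum.inr_injective), add_comm, tsum_fintype]
  congr 2
  · simp [coord]
  · rw [dirichletSum_eq_tsum (o := o), ENNReal.tsum_toReal_eq (fun _ => ENNReal.ofReal_ne_top)]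
    simp only [ENNReal.toReal_ofReal (Real.rpow_nonneg (abs_nonneg _) _)]

lemma seminormedCore : SeminormedSpace.Core ℝ (DirichletSpace G p o) where
  norm_nonneg f := by
    rw [norm_def]; positivity
  norm_smul c f := by
    have hp0 : 0 < p := by linarith [hp.out]
    have h : ∀ i, |coord (G := G) o (c • f : DirichletSpace G p o) i| ^ p =
        |c| ^ p * |coord (G := G) o f i| ^ p := by
      intro i
      rw [← Real.mul_rpow (abs_nonneg _) (abs_nonneg _), ← abs_mul]
      congr 2
      cases i with
      | inl _ => rfl
      | inr e =>
        simp only [coord]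
        split_ifs
        · simp only [smul_apply]; ring
        · simp
    rw [norm_eq_tsum, norm_eq_tsum, tsum_congr h, tsum_mul_left,
      Real.mul_rpow (by positivity) (tsum_nonneg fun i => by positivity), ← Real.rpow_mul
      (abs_nonneg c), mul_one_div_cancel hp0.ne', Real.rpow_one, Real.norm_eq_abs]
  norm_triangle f g := by
    have hp0 : 0 < p := by linarith [hp.out]
    rw [norm_eq_tsum, norm_eq_tsum f, norm_eq_tsum g]
    have hm := Real.Lp_add_le_tsum_of_nonneg (p := p) hp.out.le
      (f := fun i => |coord (G := G) o f i|) (g := fun i => |coord (G := G) o g i|)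
      (fun _ => abs_nonneg _) (fun _ => abs_nonneg _) (summable_coord f) (summable_coord g)
    refine le_trans ?_ hm.2
    refine Real.rpow_le_rpow (tsum_nonneg fun i => by positivity) ?_ (by positivity)
    refine (summable_coord (f + g)).tsum_le_tsum (fun i => ?_) hm.1
    refine Real.rpow_le_rpow (abs_nonneg _) ?_ hp0.le
    refine le_trans (le_of_eq (congrArg abs ?_)) (abs_add_le _ _)
    cases i with
    | inl _ => rfl
    | inr e =>
      simp only [coord]
      split_ifs
      · simp only [add_apply]; ring
      · simp

/- On a connected graph this seminorm is a norm. -/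
instance : SeminormedAddCommGroup (DirichletSpace G p o) :=
  SeminormedAddCommGroup.ofCore seminormedCore

instance : NormedSpace ℝ (DirichletSpace G p o) where
  norm_smul_le c f := (seminormedCore.norm_smul c f).le

end DirichletSpace

variable (o : V)

/-- The subspace `ℓ^p(G)` of `D_p(G)`. (If the degrees of `G` are bounded, every `p`-summable
function is `p`-Dirichlet finite.) -/
def ellp : Submodule ℝ (DirichletSpace G p o) where
  carrier := {f | Summable fun x => |f x| ^ p}
  add_mem' {f g} hf hg := by
    refine (Real.Lp_add_le_tsum_of_nonneg (p := p) hp.out.le (fun x => abs_nonneg (f x))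
      (fun x => abs_nonneg (g x)) hf hg).1.of_nonneg_of_le (fun x => by positivity) fun x => ?_
    exact Real.rpow_le_rpow (abs_nonneg _) (abs_add_le _ _) (by linarith [hp.out])
  zero_mem' := by
    have hp0 : p ≠ 0 := by linarith [hp.out]
    simp [Real.zero_rpow hp0, summable_zero]
  smul_mem' c f hf := by
    have h : ∀ x, |(c • f) x| ^ p = |c| ^ p * |f x| ^ p := fun x => by
      rw [DirichletSpace.smul_apply, abs_mul, Real.mul_rpow (abs_nonneg _) (abs_nonneg _)]
    simpa only [Set.mem_ofPred_eq, h] using hf.mul_left (|c| ^ p)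

/-- The subspace `ℝ` of constant functions in `D_p(G)`. -/
def constants : Submodule ℝ (DirichletSpace G p o) where
  carrier := {f | ∃ c : ℝ, ∀ x, f x = c}
  add_mem' := by
    rintro f g ⟨a, ha⟩ ⟨b, hb⟩
    exact ⟨a + b, fun x => by simp [ha, hb]⟩
  zero_mem' := ⟨0, fun _ => rfl⟩
  smul_mem' := by
    rintro c f ⟨a, ha⟩
    exact ⟨c * a, fun x => by simp [ha]⟩

/-- The set `B(closure of ℝG in D_p)`: the functions in `BD_p(G)` that are limits, in the norm of
`D_p(G)`, of finitely supported functions. -/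
def boundedClosureFinSupp : Set (BD G p) :=
  {f | DirichletSpace.mk f.1 f.2.1 ∈
    closure {g : DirichletSpace G p o | (Function.support (g : V → ℝ)).Finite}}

/-- The spectrum `Sp(BD_p(G))`: the nonzero (equivalently, unital) algebra homomorphisms
from `BD_p(G)` to `ℂ`. -/
abbrev Spectrum : Type _ := BD G p →ₐ[ℝ] ℂ

variable {G p} in
/-- The evaluation character `i(x)`, `f ↦ f(x)`. -/
def evalChar (x : V) : Spectrum G p :=
  (Algebra.ofId ℝ ℂ).comp ((Pi.evalAlgHom ℝ (fun _ : V => ℝ) x).comp (BD G p).val)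

/-- The `p`-Royden boundary `R_p(G) = Sp(BD_p(G)) \ i(V)`. -/
def roydenBoundary : Set (Spectrum G p) := (Set.range (evalChar (G := G) (p := p)))ᶜ

/-- The `p`-harmonic boundary `∂_p(G)`. -/
def harmonicBoundary : Set (Spectrum G p) :=
  {τ | τ ∈ roydenBoundary G p ∧ ∀ f ∈ boundedClosureFinSupp G p o, τ f = 0}

/-- The space `D_p(G)/ℝ`, with the quotient topology. -/
abbrev DirichletModConst : Type _ := DirichletSpace G p o ⧸ constants G p o

/-- The quotient norm on `D_p(G)/ℝ` is `I_p(f, V)^{1/p}`. -/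
lemma norm_mkQ (f : DirichletSpace G p o) :
    ‖(constants G p o).mkQ f‖ = (dirichletSum G p f).toReal ^ (1 / p) := by
  have hp0 : 0 < p := by linarith [hp.out]
  apply le_antisymm
  · let c : DirichletSpace G p o := DirichletSpace.mk (fun _ => f o) (by
      rw [dirichletSum_const hp0.ne']; exact ENNReal.zero_lt_top)
    have hc : (constants G p o).mkQ f = (constants G p o).mkQ (f - c) := by
      have h0 : (constants G p o).mkQ c = 0 :=
        (Submodule.Quotient.mk_eq_zero _).2 ⟨f o, fun _ => rfl⟩
      rw [map_sub, h0, sub_zero]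
    rw [hc]
    refine (Submodule.Quotient.norm_mk_le _ _).trans (le_of_eq ?_)
    rw [DirichletSpace.norm_def]
    have h1 : (f - c) o = 0 := sub_self _
    have h2 : dirichletSum G p (f - c : DirichletSpace G p o) = dirichletSum G p f :=
      dirichletSum_add_const (G := G) (p := p) (f : V → ℝ) (-(f o))
    rw [h1, h2, abs_zero, Real.zero_rpow hp0.ne', add_zero]
  · refine le_of_forall_pos_le_add fun ε hε => ?_
    obtain ⟨g, hg, hlt⟩ := Submodule.Quotient.norm_mk_lt ((constants G p o).mkQ f) hε
    refine le_trans ?_ hlt.le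
    have hmem : g - f ∈ constants G p o := (Submodule.Quotient.eq _).1 hg
    obtain ⟨c, hc⟩ := hmem
    have hgf : (g : V → ℝ) = fun x => f x + c := by
      funext x
      have := hc x
      simp only [DirichletSpace.sub_apply] at this
      linarith
    rw [DirichletSpace.norm_def, hgf, dirichletSum_add_const]
    refine Real.rpow_le_rpow ENNReal.toReal_nonneg ?_ (by positivity)
    exact le_add_of_nonneg_right (by positivity)

end Graph

section Group

variable {Γ : Type*} [Group Γ] (S : Finset Γ)

/-- The Cayley graph of `Γ`: `x ∼ y` iff `x ≠ y` and `x = y s` or `x = y s⁻¹` for some `s ∈ S`. -/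
abbrev cayley : SimpleGraph Γ := SimpleGraph.mulCayley (S : Set Γ)

lemma neighborSet_finite (x : Γ) : ((cayley S).neighborSet x).Finite := by
  refine ((S.finite_toSet.union S.finite_toSet.inv).image (fun s => x * s)).subset ?_
  intro y hy
  rw [SimpleGraph.mem_neighborSet, SimpleGraph.mulCayley_adj] at hy
  refine ⟨x⁻¹ * y, ?_, by simp⟩
  rcases hy.2 with h | h
  · exact Or.inl h
  · right; simpa using h

instance : (cayley S).LocallyFinite := fun x => (neighborSet_finite S x).fintype

open Classical in
lemma sum_neighborFinset {M : Type*} [AddCommMonoid M] (x : Γ) (F : Γ → M) (hF : F x = 0) :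
    ∑ y ∈ (cayley S).neighborFinset x, F y = ∑ s ∈ S ∪ S⁻¹, F (x * s) := by
  rw [← Finset.sum_image (f := F) (g := fun s => x * s) (fun a _ b _ h => mul_left_cancel h)]
  refine Finset.sum_subset ?_ ?_
  · intro y hy
    rw [SimpleGraph.mem_neighborFinset, SimpleGraph.mulCayley_adj] at hy
    refine Finset.mem_image.2 ⟨x⁻¹ * y, ?_, by simp⟩
    rcases hy.2 with h | h
    · exact Finset.mem_union_left _ h
    · exact Finset.mem_union_right _ (by simpa using h)
  · intro y hy hn
    obtain ⟨s, hs, rfl⟩ := Finset.mem_image.1 hy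
    rw [SimpleGraph.mem_neighborFinset, SimpleGraph.mulCayley_adj] at hn
    by_cases h1 : x = x * s
    · rw [← h1, hF]
    · exact absurd ⟨h1, by simpa using hs⟩ hn

open Classical in
/-- For a symmetric generating set the Dirichlet sum is `∑_x ∑_{s ∈ S} |f(x s⁻¹) - f(x)|^p`. -/
lemma dirichletSum_cayley (hS : S⁻¹ = S) {p : ℝ} (hp : p ≠ 0) (f : Γ → ℝ) :
    dirichletSum (cayley S) p f =
      ∑' x, ∑ s ∈ S, ENNReal.ofReal (|f (x * s⁻¹) - f x| ^ p) := by
  refine tsum_congr fun x => ?_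
  unfold gradPow
  rw [sum_neighborFinset S x (fun y => ENNReal.ofReal (|f y - f x| ^ p))
    (by simp [Real.zero_rpow hp]), hS, Finset.union_self]
  exact Finset.sum_nbij' (fun s => s⁻¹) (fun s => s⁻¹)
    (fun s hs => by rw [← hS]; exact Finset.inv_mem_inv hs)
    (fun s hs => by rw [← hS]; exact Finset.inv_mem_inv hs) (by simp) (by simp) (by simp)

open Classical in
/-- For a symmetric generating set the `p`-Laplacian is
`∑_{s ∈ S} |f(x s⁻¹) - f(x)|^{p-2} (f(x s⁻¹) - f(x))`. -/
lemma pLaplacian_cayley (hS : S⁻¹ = S) (p : ℝ) (f : Γ → ℝ) (x : Γ) :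
    pLaplacian (cayley S) p f x =
      ∑ s ∈ S, |f (x * s⁻¹) - f x| ^ (p - 2) * (f (x * s⁻¹) - f x) := by
  unfold pLaplacian
  rw [sum_neighborFinset S x (fun y => |f y - f x| ^ (p - 2) * (f y - f x)) (by simp), hS,
    Finset.union_self]
  exact Finset.sum_nbij' (fun s => s⁻¹) (fun s => s⁻¹)
    (fun s hs => by rw [← hS]; exact Finset.inv_mem_inv hs)
    (fun s hs => by rw [← hS]; exact Finset.inv_mem_inv hs) (by simp) (by simp) (by simp)

/-- `∑_x |f(x t) - f(x)|^p`. -/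
def shiftSum (p : ℝ) (f : Γ → ℝ) (t : Γ) : ℝ≥0∞ := ∑' x, ENNReal.ofReal (|f (x * t) - f x| ^ p)

open Classical in
lemma dirichletSum_eq_sum_shiftSum {p : ℝ} (hp : p ≠ 0) (f : Γ → ℝ) :
    dirichletSum (cayley S) p f = ∑ s ∈ S ∪ S⁻¹, shiftSum p f s := by
  unfold shiftSum
  rw [← Summable.tsum_finsetSum (fun _ _ => ENNReal.summable)]
  refine tsum_congr fun x => ?_
  unfold gradPow
  rw [sum_neighborFinset S x (fun y => ENNReal.ofReal (|f y - f x| ^ p))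
    (by simp [Real.zero_rpow hp])]

lemma shiftSum_inv (p : ℝ) (f : Γ → ℝ) (t : Γ) : shiftSum p f t⁻¹ = shiftSum p f t := by
  unfold shiftSum
  rw [← (Equiv.mulRight t).tsum_eq]
  refine tsum_congr fun x => ?_
  simp [abs_sub_comm]

lemma shiftSum_mul_lt_top {p : ℝ} (hp : 0 ≤ p) (f : Γ → ℝ) {t u : Γ}
    (ht : shiftSum p f t < ∞) (hu : shiftSum p f u < ∞) : shiftSum p f (t * u) < ∞ := by
  have hu' : ∑' x, ENNReal.ofReal (|f (x * t * u) - f (x * t)| ^ p) = shiftSum p f u :=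
    (Equiv.mulRight t).tsum_eq fun x => ENNReal.ofReal (|f (x * u) - f x| ^ p)
  have hle : shiftSum p f (t * u) ≤
      ENNReal.ofReal (2 ^ p) * (shiftSum p f u + shiftSum p f t) := by
    rw [← hu']
    unfold shiftSum
    rw [← ENNReal.tsum_add, ← ENNReal.tsum_mul_left]
    refine ENNReal.tsum_le_tsum fun x => ?_
    rw [← ENNReal.ofReal_add (by positivity) (by positivity), ← ENNReal.ofReal_mul (by positivity)]
    apply ENNReal.ofReal_le_ofReal
    refine le_trans (Real.rpow_le_rpow (abs_nonneg _) ?_ hp)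
      (add_rpow_bound hp (abs_nonneg _) (abs_nonneg _))
    rw [← mul_assoc]
    exact abs_sub_le _ _ _
  exact hle.trans_lt (ENNReal.mul_lt_top ENNReal.ofReal_lt_top (ENNReal.add_lt_top.2 ⟨hu, ht⟩))

variable {S}

lemma shiftSum_lt_top (hS : Subgroup.closure (S : Set Γ) = ⊤) {p : ℝ} (hp : 0 < p) {f : Γ → ℝ}
    (hf : dirichletSum (cayley S) p f < ∞) (t : Γ) : shiftSum p f t < ∞ := by
  classical
  have ht : t ∈ Subgroup.closure (S : Set Γ) := hS ▸ Subgroup.mem_top t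
  induction ht using Subgroup.closure_induction with
  | mem s hs =>
    rw [dirichletSum_eq_sum_shiftSum S hp.ne'] at hf
    exact ENNReal.sum_lt_top.1 hf s (Finset.mem_union_left _ hs)
  | one => simp [shiftSum, Real.zero_rpow hp.ne']
  | mul t u _ _ ht hu => exact shiftSum_mul_lt_top hp.le f ht hu
  | inv t _ ht => rwa [shiftSum_inv]

/-- `D_p(Γ)` is right translation invariant. -/
lemma dirichletSum_translate_lt_top (hS : Subgroup.closure (S : Set Γ) = ⊤) {p : ℝ} (hp : 0 < p)
    {f : Γ → ℝ} (hf : dirichletSum (cayley S) p f < ∞) (x : Γ) :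
    dirichletSum (cayley S) p (fun g => f (g * x⁻¹)) < ∞ := by
  classical
  rw [dirichletSum_eq_sum_shiftSum S hp.ne', ENNReal.sum_lt_top]
  intro s _
  have h : shiftSum p (fun g => f (g * x⁻¹)) s = shiftSum p f (x * s * x⁻¹) := by
    unfold shiftSum
    rw [← (Equiv.mulRight x).tsum_eq]
    refine tsum_congr fun y => ?_
    simp [mul_assoc]
  rw [h]
  exact shiftSum_lt_top hS hp hf _

variable (S) (p : ℝ) [hp : Fact (1 < p)]

/-- The first reduced `ℓ^p`-cohomology space: `D_p(Γ)` modulo the `D_p`-closure of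
`ℓ^p(Γ) ⊕ ℝ`. -/
abbrev reducedCohomology : Type _ :=
  DirichletSpace (cayley S) p (1 : Γ) ⧸
    (ellp (cayley S) p (1 : Γ) ⊔ constants (cayley S) p (1 : Γ)).topologicalClosure

variable {S}

/-- Right translation `f ↦ f_x`, `f_x(g) = f(g x⁻¹)`, on `D_p(Γ)`. -/
def translate (hS : Subgroup.closure (S : Set Γ) = ⊤) (x : Γ) :
    DirichletSpace (cayley S) p (1 : Γ) →ₗ[ℝ] DirichletSpace (cayley S) p (1 : Γ) where
  toFun f := DirichletSpace.mk (fun g => f (g * x⁻¹))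
    (dirichletSum_translate_lt_top hS (by linarith [hp.out]) f.dirichletSum_lt_top x)
  map_add' _ _ := rfl
  map_smul' _ _ := rfl

/-- Right translation on `D_p(Γ)/ℝ`. -/
def translateMod (hS : Subgroup.closure (S : Set Γ) = ⊤) (x : Γ) :
    DirichletModConst (cayley S) p (1 : Γ) →ₗ[ℝ] DirichletModConst (cayley S) p (1 : Γ) :=
  (constants (cayley S) p (1 : Γ)).mapQ (constants (cayley S) p (1 : Γ)) (translate p hS x) (by
    rintro f ⟨c, hc⟩
    exact ⟨c, fun g => hc (g * x⁻¹)⟩)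

/-- `T` is a translation invariant linear functional (TILF) on `D_p(Γ)/ℝ`. -/
def IsTILF (hS : Subgroup.closure (S : Set Γ) = ⊤)
    (T : DirichletModConst (cayley S) p (1 : Γ) →ₗ[ℝ] ℝ) : Prop :=
  ∀ (x : Γ) (u : DirichletModConst (cayley S) p (1 : Γ)), T (translateMod p hS x u) = T u

/-- A (discrete) group is amenable if it carries a left invariant finitely additive probability
measure defined on all subsets. -/
def IsAmenable (Γ : Type*) [Group Γ] : Prop :=
  ∃ m : Set Γ → ℝ≥0∞, m Set.univ = 1 ∧ (∀ s t, Disjoint s t → m (s ∪ t) = m s + m t) ∧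
    ∀ (g : Γ) (s : Set Γ), m (g • s) = m s

end Group

end PHarm

end

open Filter Topology

noncomputable section

namespace PHarm

/-! ### Dirichlet sums as series over ordered pairs of vertices, and convergence in D_p. -/

section Graph

variable {V : Type*} {G : SimpleGraph V} {p : ℝ}

/-! Every condition is compared with a single one: D_p is the sum of the closure of the finitely
supported functions and the constants, that is, `closureFinSuppSupConst` is everything. This sum is
closed because the constants are finite-dimensional. On a Cayley graph the degrees are bounded, so
the ℓ^p-norm dominates the Dirichlet seminorm, finitely supported functions are dense in ℓ^p for
D_p, and the sum is exactly the closure of ℓ^p ⊕ ℝ (`topologicalClosure_ellp_sup_constants`). Hence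
it is all of D_p iff the reduced cohomology vanishes.

Harmonic functions. A p-harmonic function minimizes the energy I_p under finitely supported
perturbations, and conversely. Minimizing I_p over f + (finitely supported) for bounded f, with
uniform convexity to make minimizing sequences Cauchy, gives the Royden decomposition
(`exists_bounded_isPHarmonic`); as bounded functions are dense, BHD_p = ℝ forces the closure
condition. Conversely, under that condition a harmonic f can be perturbed to a constant, so its
energy is 0 and f is constant by connectedness (`HD_eq_constFun`).

Boundary. The bounded functions in the closure form an ideal of BD_p, and the boundary consists of
the characters killing it. If f - c is in the ideal, all these characters take the value c at f.
Conversely, the ideal defines a filter on the vertices, finer ultrafilters give boundary points, and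
a single boundary point means that every bounded f has a limit c along the filter. Cutting f - c off
near 0 then puts it in the ideal up to a small error (`eq_top_of_harmonicBoundary`).

Functionals. Since f_x - f is in ℓ^p, a continuous functional killing ℓ^p and the constants is a
TILF; Hahn-Banach supplies a nonzero one when the closure is proper. Conversely, a TILF is constant
on point masses, and uniform averages of point masses tend to 0 in D_p because p > 1, so a
continuous TILF kills all finitely supported functions.

Nonamenable case. Here the ℓ^p-norm of a finitely supported function is bounded by its differences
along generators (`exists_tsum_le_sum_shiftSum`): otherwise normalized densities |f_n|^p would have
an invariant mean as a limit. At exponent p this puts the closure of the finitely supported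
functions inside ℓ^p. At the conjugate exponent q it dualizes to the statement that every
ℓ^p-function is a finite sum of differences h_s - h, which any TILF kills. -/

open Classical in
/-- The difference of `f` along an ordered pair of adjacent vertices, and `0` on other pairs. -/
def edgeDiff (G : SimpleGraph V) (f : V → ℝ) (e : V × V) : ℝ :=
  if G.Adj e.1 e.2 then f e.2 - f e.1 else 0

lemma edgeDiff_le {f g k : V → ℝ} {a b : ℝ}
    (hk : ∀ x y, |k y - k x| ≤ a * |f y - f x| + b * |g y - g x|) (e : V × V) :
    |edgeDiff G k e| ≤ a * |edgeDiff G f e| + b * |edgeDiff G g e| := by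
  unfold edgeDiff
  split_ifs
  · exact hk _ _
  · simp

/-- Dominated convergence for series, obtained from the real-valued version since all terms and sums
are finite. -/
lemma tendsto_tsum_zero_of_dominated {α ι : Type*} {l : Filter ι} {c : ι → α → ℝ≥0∞}
    {B : α → ℝ≥0∞} (hB : ∑' a, B a ≠ ∞) (hc : ∀ n a, c n a ≤ B a)
    (h : ∀ a, Tendsto (fun n => c n a) l (𝓝 0)) :
    Tendsto (fun n => ∑' a, c n a) l (𝓝 0) := by
  have hBa : ∀ a, B a ≠ ∞ := ENNReal.ne_top_of_tsum_ne_top hB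
  have hcn : ∀ n, ∑' a, c n a ≠ ∞ := fun n =>
    ne_top_of_le_ne_top hB (ENNReal.tsum_le_tsum (hc n))
  rw [← ENNReal.tendsto_toReal_iff hcn ENNReal.zero_ne_top]
  have hr : ∀ n, (∑' a, c n a).toReal = ∑' a, (c n a).toReal := fun n =>
    ENNReal.tsum_toReal_eq fun a => ne_top_of_le_ne_top (hBa a) (hc n a)
  simp only [hr]
  have := tendsto_tsum_of_dominated_convergence (𝓕 := l) (f := fun n a => (c n a).toReal)
    (g := fun _ => (0 : ℝ)) (bound := fun a => (B a).toReal) (ENNReal.summable_toReal hB)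
    (fun a => by
      have := (ENNReal.tendsto_toReal_iff
        (fun n => ne_top_of_le_ne_top (hBa a) (hc n a)) ENNReal.zero_ne_top).2 (h a)
      simpa using this)
    (Eventually.of_forall fun n a => by
      rw [Real.norm_of_nonneg ENNReal.toReal_nonneg]
      exact ENNReal.toReal_mono (hBa a) (hc n a))
  simpa using this

variable [G.LocallyFinite]

lemma dirichletSum_eq_tsum_edgeDiff (hp : p ≠ 0) (f : V → ℝ) :
    dirichletSum G p f = ∑' e : V × V, ENNReal.ofReal (|edgeDiff G f e| ^ p) := by
  rw [ENNReal.summable.tsum_prod' (fun _ => ENNReal.summable)]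
  refine tsum_congr fun x => ?_
  rw [tsum_eq_sum (s := G.neighborFinset x)]
  · refine Finset.sum_congr rfl fun y hy => ?_
    rw [SimpleGraph.mem_neighborFinset] at hy
    simp [edgeDiff, hy]
  · intro y hy
    rw [SimpleGraph.mem_neighborFinset] at hy
    simp [edgeDiff, hy, Real.zero_rpow hp]

lemma dirichletSum_mono (hp : 0 ≤ p) {f k : V → ℝ}
    (hk : ∀ x y, |k y - k x| ≤ |f y - f x|) : dirichletSum G p k ≤ dirichletSum G p f :=
  ENNReal.tsum_le_tsum fun x => Finset.sum_le_sum fun y _ =>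
    ENNReal.ofReal_le_ofReal (Real.rpow_le_rpow (abs_nonneg _) (hk x y) hp)

lemma summable_edgeDiff (hp : p ≠ 0) {f : V → ℝ} (hf : dirichletSum G p f < ∞) :
    Summable fun e => |edgeDiff G f e| ^ p := by
  rw [dirichletSum_eq_tsum_edgeDiff hp] at hf
  have h2 := ENNReal.summable_toReal hf.ne
  simpa only [ENNReal.toReal_ofReal (Real.rpow_nonneg (abs_nonneg _) _)] using h2

lemma toReal_dirichletSum (hp : p ≠ 0) (f : V → ℝ) :
    (dirichletSum G p f).toReal = ∑' e, |edgeDiff G f e| ^ p := by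
  rw [dirichletSum_eq_tsum_edgeDiff hp,
    ENNReal.tsum_toReal_eq (fun _ => ENNReal.ofReal_ne_top)]
  simp only [ENNReal.toReal_ofReal (Real.rpow_nonneg (abs_nonneg _) _)]

/-- Lower semicontinuity of the Dirichlet sum under pointwise convergence. -/
lemma dirichletSum_le_of_tendsto (hp : 0 < p) {ι : Type*} {l : Filter ι} [l.NeBot]
    {u : ι → V → ℝ} {f : V → ℝ} {c : ℝ≥0∞} (hu : ∀ x, Tendsto (fun n => u n x) l (𝓝 (f x)))
    (hc : ∀ᶠ n in l, dirichletSum G p (u n) ≤ c) : dirichletSum G p f ≤ c := by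
  rw [dirichletSum_eq_tsum_edgeDiff hp.ne']
  -- Finite partial sums are continuous under pointwise convergence, and each is at most the whole
  -- sum.
  rw [ENNReal.tsum_eq_iSup_sum]
  refine iSup_le fun s => ?_
  have ht : Tendsto (fun n => ∑ e ∈ s, ENNReal.ofReal (|edgeDiff G (u n) e| ^ p)) l
      (𝓝 (∑ e ∈ s, ENNReal.ofReal (|edgeDiff G f e| ^ p))) := by
    refine tendsto_finsetSum _ fun e _ => ?_
    refine (ENNReal.continuous_ofReal.tendsto _).comp ?_
    refine Tendsto.rpow_const ?_ (Or.inr hp.le)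
    refine Tendsto.abs ?_
    unfold edgeDiff
    split_ifs
    · exact (hu _).sub (hu _)
    · exact tendsto_const_nhds
  refine le_of_tendsto ht (hc.mono fun n hn => ?_)
  refine le_trans ?_ hn
  rw [dirichletSum_eq_tsum_edgeDiff hp.ne']
  exact ENNReal.sum_le_tsum s

/-- A generalized dominated convergence theorem for Dirichlet sums. -/
lemma tendsto_dirichletSum_zero (hp : 0 < p) {ι : Type*} {l : Filter ι} {u r : ι → V → ℝ}
    {f : V → ℝ} {A K : ℝ} (hA : 0 ≤ A) (hK : 0 ≤ K) (hf : dirichletSum G p f < ∞)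
    (hle : ∀ n x y, |u n y - u n x| ≤ A * |r n y - r n x| + K * |f y - f x|)
    (hr : Tendsto (fun n => dirichletSum G p (r n)) l (𝓝 0))
    (hu : ∀ x, Tendsto (fun n => u n x) l (𝓝 0)) :
    Tendsto (fun n => dirichletSum G p (u n)) l (𝓝 0) := by
  -- The difference of `u n` is capped at K|Df|. Dominated convergence handles the capped part; the
  -- excess is at most A times the difference of `r n`, whose energy tends to 0.
  set c : ι → V × V → ℝ≥0∞ := fun n e =>
    ENNReal.ofReal (min |edgeDiff G (u n) e| (K * |edgeDiff G f e|) ^ p) with hcdef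
  have hmin0 : ∀ n e, 0 ≤ min |edgeDiff G (u n) e| (K * |edgeDiff G f e|) := fun n e =>
    le_min (abs_nonneg _) (by positivity)
  have hc : Tendsto (fun n => ∑' e, c n e) l (𝓝 0) := by
    refine tendsto_tsum_zero_of_dominated
      (B := fun e => ENNReal.ofReal (K ^ p) * ENNReal.ofReal (|edgeDiff G f e| ^ p)) ?_ ?_ ?_
    · rw [ENNReal.tsum_mul_left, ← dirichletSum_eq_tsum_edgeDiff hp.ne']
      exact (ENNReal.mul_lt_top ENNReal.ofReal_lt_top hf).ne
    · intro n e
      rw [← ENNReal.ofReal_mul (by positivity), ← Real.mul_rpow hK (abs_nonneg _)]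
      exact ENNReal.ofReal_le_ofReal
        (Real.rpow_le_rpow (hmin0 n e) (min_le_right _ _) hp.le)
    · intro e
      have h1 : Tendsto (fun n => |edgeDiff G (u n) e| ^ p) l (𝓝 0) := by
        have h0 : Tendsto (fun n => edgeDiff G (u n) e) l (𝓝 0) := by
          unfold edgeDiff
          split_ifs
          · simpa using (hu e.2).sub (hu e.1)
          · exact tendsto_const_nhds
        have := (h0.abs).rpow_const (p := p) (Or.inr hp.le)
        simpa [Real.zero_rpow hp.ne'] using this
      have h2 : Tendsto (fun n => min |edgeDiff G (u n) e| (K * |edgeDiff G f e|) ^ p) l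
          (𝓝 0) :=
        squeeze_zero (fun n => Real.rpow_nonneg (hmin0 n e) p)
          (fun n => Real.rpow_le_rpow (hmin0 n e) (min_le_left _ _) hp.le) h1
      have h3 := (ENNReal.continuous_ofReal.tendsto 0).comp h2
      rwa [ENNReal.ofReal_zero] at h3
  have hbound : ∀ n, dirichletSum G p (u n) ≤ ENNReal.ofReal (2 ^ p * A ^ p) *
      dirichletSum G p (r n) + ENNReal.ofReal (2 ^ p) * ∑' e, c n e := by
    intro n
    rw [dirichletSum_eq_tsum_edgeDiff hp.ne', dirichletSum_eq_tsum_edgeDiff hp.ne',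
      ← ENNReal.tsum_mul_left, ← ENNReal.tsum_mul_left, ← ENNReal.tsum_add]
    refine ENNReal.tsum_le_tsum fun e => ?_
    rw [← ENNReal.ofReal_mul (by positivity), ← ENNReal.ofReal_mul (by positivity),
      ← ENNReal.ofReal_add (by positivity)
        (mul_nonneg (by positivity) (Real.rpow_nonneg (hmin0 n e) p))]
    refine ENNReal.ofReal_le_ofReal ?_
    have h1 : |edgeDiff G (u n) e| ≤ A * |edgeDiff G (r n) e| +
        min |edgeDiff G (u n) e| (K * |edgeDiff G f e|) := by
      have h2 := edgeDiff_le (G := G) (hle n) e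
      have h3 : 0 ≤ A * |edgeDiff G (r n) e| := by positivity
      rcases min_choice |edgeDiff G (u n) e| (K * |edgeDiff G f e|) with h | h <;> rw [h] <;>
        linarith
    refine (Real.rpow_le_rpow (abs_nonneg _) h1 hp.le).trans
      ((add_rpow_bound hp.le (by positivity) (hmin0 n e)).trans (le_of_eq ?_))
    rw [Real.mul_rpow hA (abs_nonneg _)]; ring
  refine tendsto_of_tendsto_of_tendsto_of_le_of_le tendsto_const_nhds ?_ (fun _ => zero_le)
    hbound
  have h1 := ENNReal.Tendsto.const_mul (a := ENNReal.ofReal (2 ^ p * A ^ p)) hr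
    (Or.inr ENNReal.ofReal_ne_top)
  have h2 := ENNReal.Tendsto.const_mul (a := ENNReal.ofReal (2 ^ p)) hc
    (Or.inr ENNReal.ofReal_ne_top)
  simpa using h1.add h2

/-- If the Dirichlet sums tend to `0` and the values at a vertex tend to `0`, then so do the values
at every vertex. -/
lemma tendsto_apply_of_tendsto_dirichletSum (hG : G.Preconnected) (hp : 0 < p) {ι : Type*}
    {l : Filter ι} {u : ι → V → ℝ} {o : V}
    (hu : Tendsto (fun n => dirichletSum G p (u n)) l (𝓝 0))
    (ho : Tendsto (fun n => u n o) l (𝓝 0)) (x : V) : Tendsto (fun n => u n x) l (𝓝 0) := by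
  obtain ⟨w⟩ := hG x o
  induction w with
  | nil => exact ho
  | @cons a b c hab _ ih =>
    have h1 : Tendsto (fun n => u n b - u n a) l (𝓝 0) := by
      have hle : ∀ n, ENNReal.ofReal (|u n b - u n a| ^ p) ≤ dirichletSum G p (u n) := by
        intro n
        rw [dirichletSum_eq_tsum_edgeDiff hp.ne']
        refine le_trans (le_of_eq ?_) (ENNReal.le_tsum (a, b))
        simp [edgeDiff, hab]
      have h2 := tendsto_of_tendsto_of_tendsto_of_le_of_le tendsto_const_nhds hu
        (fun _ => zero_le) hle
      have h3 := (ENNReal.tendsto_toReal ENNReal.zero_ne_top).comp h2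
      have h4 : Tendsto (fun n => |u n b - u n a| ^ p) l (𝓝 0) := by
        refine h3.congr fun n => ?_
        simp [ENNReal.toReal_ofReal (Real.rpow_nonneg (abs_nonneg _) p)]
      have h5 := h4.rpow_const (p := 1 / p) (Or.inr (by positivity))
      rw [Real.zero_rpow (by positivity)] at h5
      rw [tendsto_zero_iff_abs_tendsto_zero]
      refine h5.congr fun n => ?_
      rw [← Real.rpow_mul (abs_nonneg _), mul_one_div_cancel hp.ne', Real.rpow_one]; rfl
    simpa using (ih ho).sub h1

lemma eq_of_dirichletSum_eq_zero (hG : G.Preconnected) (hp : 0 < p) {f : V → ℝ}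
    (hf : dirichletSum G p f = 0) (x y : V) : f x = f y := by
  have h := tendsto_apply_of_tendsto_dirichletSum (G := G) hG hp (l := (atTop : Filter ℕ))
    (u := fun _ x => f x - f y) (o := y)
    (by simp [sub_eq_add_neg, dirichletSum_add_const, hf])
    (by simp) x
  have := tendsto_nhds_unique h tendsto_const_nhds
  linarith

namespace DirichletSpace

variable [hp : Fact (1 < p)] {o : V}

/-- Removes the outer root from the norm, so that limit theorems for the energy apply directly. -/
lemma tendsto_iff {ι : Type*} {l : Filter ι} {u : ι → DirichletSpace G p o}
    {f : DirichletSpace G p o} : Tendsto u l (𝓝 f) ↔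
      Tendsto (fun n => dirichletSum G p (fun x => u n x - f x)) l (𝓝 0) ∧
        Tendsto (fun n => u n o) l (𝓝 (f o)) := by
  have hp0 : 0 < p := by linarith [hp.out]
  rw [tendsto_iff_norm_sub_tendsto_zero]
  have e1 : ∀ n, ‖u n - f‖ = ((dirichletSum G p (fun x => u n x - f x)).toReal +
    |u n o - f o| ^ p) ^ (1 / p) := fun n => norm_def _
  have hfin : ∀ n, dirichletSum G p (fun x => u n x - f x) ≠ ∞ := fun n =>
    (u n - f).dirichletSum_lt_top.ne
  simp only [e1]
  rw [← ENNReal.tendsto_toReal_iff hfin ENNReal.zero_ne_top, ENNReal.toReal_zero,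
    tendsto_iff_norm_sub_tendsto_zero (f := fun n => u n o)]
  simp only [Real.norm_eq_abs]
  constructor
  · intro h
    have h1 : Tendsto (fun n => (dirichletSum G p (fun x => u n x - f x)).toReal +
        |u n o - f o| ^ p) l (𝓝 0) := by
      have h2 := h.rpow_const (p := p) (Or.inr hp0.le)
      rw [Real.zero_rpow hp0.ne'] at h2
      refine h2.congr fun n => ?_
      rw [← Real.rpow_mul (by positivity), one_div_mul_cancel hp0.ne', Real.rpow_one]
    refine ⟨squeeze_zero (fun n => ENNReal.toReal_nonneg)
      (fun n => le_add_of_nonneg_right (by positivity)) h1, ?_⟩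
    have h3 : Tendsto (fun n => |u n o - f o| ^ p) l (𝓝 0) :=
      squeeze_zero (fun n => by positivity)
        (fun n => le_add_of_nonneg_left ENNReal.toReal_nonneg) h1
    have h5 := h3.rpow_const (p := 1 / p) (Or.inr (by positivity))
    rw [Real.zero_rpow (by positivity)] at h5
    refine h5.congr fun n => ?_
    rw [← Real.rpow_mul (abs_nonneg _), mul_one_div_cancel hp0.ne', Real.rpow_one]
  · rintro ⟨h1, h2⟩
    have h3 := h2.rpow_const (p := p) (Or.inr hp0.le)
    have h4 := (h1.add h3).rpow_const (p := 1 / p) (Or.inr (by positivity))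
    simpa [Real.zero_rpow hp0.ne', hp0.ne'] using h4

/-- On a connected graph, evaluation at any vertex is continuous: the value at the base vertex is
part of the norm, and a walk carries the control to the other vertices. -/
lemma tendsto_apply (hG : G.Preconnected) {ι : Type*} {l : Filter ι}
    {u : ι → DirichletSpace G p o} {f : DirichletSpace G p o} (h : Tendsto u l (𝓝 f)) (x : V) :
    Tendsto (fun n => u n x) l (𝓝 (f x)) := by
  obtain ⟨h1, h2⟩ := tendsto_iff.1 h
  have := tendsto_apply_of_tendsto_dirichletSum hG (by linarith [hp.out]) h1
    (by simpa using h2.sub_const (f o)) x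
  simpa using this.add_const (f x)

end DirichletSpace

end Graph

/-! ### Convexity and homogeneity inequalities for powers of the absolute value. -/

section RealInequalities

variable {p : ℝ}

/-- A compactness principle for continuous homogeneous functions on the plane: if `Q ≥ 0` and
`P ≤ 0` wherever `Q` vanishes, then `P` is bounded by a multiple of `Q` up to a small error. -/
lemma exists_homogeneous_bound (hp : 0 < p) {P Q : ℝ × ℝ → ℝ} (hP : Continuous P)
    (hQ : Continuous Q) (hPh : ∀ t : ℝ, 0 < t → ∀ z, P (t • z) = t ^ p * P z)
    (hQh : ∀ t : ℝ, 0 < t → ∀ z, Q (t • z) = t ^ p * Q z) (hQ0 : ∀ z, 0 ≤ Q z)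
    (hPQ : ∀ z, Q z = 0 → P z ≤ 0) {η : ℝ} (hη : 0 < η) :
    ∃ C : ℝ, 0 ≤ C ∧ ∀ z : ℝ × ℝ, P z ≤ η * (|z.1| ^ p + |z.2| ^ p) + C * Q z := by
  have hK : IsCompact (Metric.sphere (0 : ℝ × ℝ) 1) := isCompact_sphere 0 1
  -- On this compact part of the unit sphere Q cannot vanish, so max P / min Q serves as C; on the
  -- rest of the sphere P < η, and |z.1|^p + |z.2|^p ≥ 1 there.
  have hK' : IsCompact (Metric.sphere (0 : ℝ × ℝ) 1 ∩ {z | η ≤ P z}) :=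
    hK.inter_right (isClosed_le continuous_const hP)
  obtain ⟨C, hC, hsph⟩ : ∃ C : ℝ, 0 ≤ C ∧ ∀ z ∈ Metric.sphere (0 : ℝ × ℝ) 1,
      P z ≤ η * (|z.1| ^ p + |z.2| ^ p) + C * Q z := by
    have hge : ∀ z ∈ Metric.sphere (0 : ℝ × ℝ) 1, 1 ≤ |z.1| ^ p + |z.2| ^ p := by
      intro z hz
      rw [mem_sphere_zero_iff_norm, Prod.norm_def, Real.norm_eq_abs, Real.norm_eq_abs] at hz
      have h1 : 0 ≤ |z.1| ^ p := by positivity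
      have h2 : 0 ≤ |z.2| ^ p := by positivity
      rcases max_choice |z.1| |z.2| with h | h <;> rw [h] at hz <;> rw [hz, Real.one_rpow] <;>
        linarith
    rcases (Metric.sphere (0 : ℝ × ℝ) 1 ∩ {z | η ≤ P z}).eq_empty_or_nonempty with he | hne
    · refine ⟨0, le_rfl, fun z hz => ?_⟩
      have h1 : ¬ η ≤ P z := fun h => by
        have : z ∈ Metric.sphere (0 : ℝ × ℝ) 1 ∩ {z | η ≤ P z} := ⟨hz, h⟩
        rw [he] at this; exact this
      nlinarith [hge z hz]
    · obtain ⟨w, hw, hmin⟩ := hK'.exists_isMinOn hne hQ.continuousOn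
      obtain ⟨v, hv, hmax⟩ := hK'.exists_isMaxOn hne hP.continuousOn
      have hw0 : 0 < Q w := by
        refine lt_of_le_of_ne (hQ0 w) fun h => ?_
        have h1 := hPQ w h.symm
        have h2 : η ≤ P w := hw.2
        linarith
      have hv0 : 0 < P v := hη.trans_le hv.2
      refine ⟨P v / Q w, by positivity, fun z hz => ?_⟩
      by_cases hz2 : η ≤ P z
      · have h1 : P z ≤ P v := hmax ⟨hz, hz2⟩
        have h2 : Q w ≤ Q z := hmin ⟨hz, hz2⟩
        have h3 : P v ≤ P v / Q w * Q z := by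
          rw [div_mul_eq_mul_div, le_div_iff₀ hw0]
          exact mul_le_mul_of_nonneg_left h2 hv0.le
        have h4 : 0 ≤ η * (|z.1| ^ p + |z.2| ^ p) := by positivity
        linarith
      · have h3 : 0 ≤ P v / Q w * Q z := mul_nonneg (by positivity) (hQ0 z)
        nlinarith [hge z hz]
  refine ⟨C, hC, fun z => ?_⟩
  by_cases hz : z = 0
  -- Homogeneity is assumed only for positive factors; the factor 2 forces P 0 = 0 because 2^p > 1.
  · have h2 := hPh 2 two_pos 0
    rw [smul_zero] at h2
    have h3 : (1 : ℝ) < 2 ^ p := Real.one_lt_rpow one_lt_two hp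
    have h4 : P 0 = 0 := by
      have : P 0 * (2 ^ p - 1) = 0 := by linarith
      rcases mul_eq_zero.1 this with h | h
      · exact h
      · linarith
    rw [hz, h4]
    have := hQ0 0
    positivity
  · have hn : 0 < ‖z‖ := norm_pos_iff.2 hz
    set w : ℝ × ℝ := ‖z‖⁻¹ • z with hwdef
    have hzw : z = ‖z‖ • w := by rw [hwdef, smul_inv_smul₀ hn.ne']
    have hw : w ∈ Metric.sphere (0 : ℝ × ℝ) 1 := by
      rw [mem_sphere_zero_iff_norm, hwdef, norm_smul, norm_inv, norm_norm,
        inv_mul_cancel₀ hn.ne']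
    have h1 := mul_le_mul_of_nonneg_left (hsph w hw) (Real.rpow_nonneg hn.le p)
    have e1 : |z.1| ^ p = ‖z‖ ^ p * |w.1| ^ p := by
      conv_lhs => rw [hzw]
      rw [Prod.smul_fst, smul_eq_mul, abs_mul, abs_of_pos hn,
        Real.mul_rpow hn.le (abs_nonneg _)]
    have e2 : |z.2| ^ p = ‖z‖ ^ p * |w.2| ^ p := by
      conv_lhs => rw [hzw]
      rw [Prod.smul_snd, smul_eq_mul, abs_mul, abs_of_pos hn,
        Real.mul_rpow hn.le (abs_nonneg _)]
    have e3 : P z = ‖z‖ ^ p * P w := by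
      conv_lhs => rw [hzw]
      exact hPh _ hn w
    have e4 : Q z = ‖z‖ ^ p * Q w := by
      conv_lhs => rw [hzw]
      exact hQh _ hn w
    rw [e1, e2, e3, e4]
    calc _ ≤ _ := h1
      _ = _ := by ring

lemma continuous_abs_rpow (hp : 0 ≤ p) {X : Type*} [TopologicalSpace X] {f : X → ℝ}
    (hf : Continuous f) : Continuous fun x => |f x| ^ p :=
  hf.abs.rpow_const fun _ => Or.inr hp

lemma convexOn_abs_rpow (hp : 1 ≤ p) : ConvexOn ℝ Set.univ fun x : ℝ => |x| ^ p := by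
  refine ⟨convex_univ, fun x _ y _ a b ha hb hab => ?_⟩
  have h1 : |a • x + b • y| ≤ a • |x| + b • |y| := by
    refine (abs_add_le _ _).trans ?_
    simp [abs_mul, abs_of_nonneg ha, abs_of_nonneg hb]
  exact (Real.rpow_le_rpow (abs_nonneg _) h1 (by linarith)).trans
    ((convexOn_rpow hp).2 (abs_nonneg x) (abs_nonneg y) ha hb hab)

/-- Strict convexity of t^p on [0, ∞) settles |a| ≠ |b|. If |a| = |b| with a ≠ b, then a = -b and
the midpoint is 0. -/
lemma abs_midpoint_rpow_lt (hp : 1 < p) {a b : ℝ} (hab : a ≠ b) :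
    |(a + b) / 2| ^ p < (|a| ^ p + |b| ^ p) / 2 := by
  have hp0 : 0 < p := by linarith
  by_cases h : |a| = |b|
  · have hb : a = -b := (abs_eq_abs.1 h).resolve_left hab
    have hb0 : b ≠ 0 := fun h0 => hab (by rw [hb, h0, neg_zero])
    have : 0 < |b| ^ p := Real.rpow_pos_of_pos (abs_pos.2 hb0) p
    rw [h, hb]
    simp only [neg_add_cancel, zero_div, abs_zero, Real.zero_rpow hp0.ne']
    linarith
  · have h1 := (strictConvexOn_rpow hp).2 (abs_nonneg a) (abs_nonneg b) h
      (show (0 : ℝ) < 1 / 2 by norm_num) (show (0 : ℝ) < 1 / 2 by norm_num) (by norm_num)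
    simp only [smul_eq_mul] at h1
    have h2 : |(a + b) / 2| ≤ 1 / 2 * |a| + 1 / 2 * |b| := by
      rw [abs_div, abs_two]
      linarith [abs_add_le a b]
    calc _ ≤ (1 / 2 * |a| + 1 / 2 * |b|) ^ p :=
          Real.rpow_le_rpow (abs_nonneg _) h2 hp0.le
      _ < _ := h1
      _ = _ := by ring

/-- Uniform convexity of `|·| ^ p`. -/
lemma exists_abs_sub_rpow_le (hp : 1 < p) {η : ℝ} (hη : 0 < η) :
    ∃ C : ℝ, 0 ≤ C ∧ ∀ a b : ℝ, |a - b| ^ p ≤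
      η * (|a| ^ p + |b| ^ p) + C * ((|a| ^ p + |b| ^ p) / 2 - |(a + b) / 2| ^ p) := by
  have hp0 : 0 < p := by linarith
  obtain ⟨C, hC, h⟩ := exists_homogeneous_bound hp0 (P := fun z => |z.1 - z.2| ^ p)
    (Q := fun z => (|z.1| ^ p + |z.2| ^ p) / 2 - |(z.1 + z.2) / 2| ^ p)
    (continuous_abs_rpow hp0.le (by fun_prop))
    ((((continuous_abs_rpow hp0.le continuous_fst).add
      (continuous_abs_rpow hp0.le continuous_snd)).div_const 2).sub
      (continuous_abs_rpow hp0.le (by fun_prop)))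
    (fun t ht z => by
      simp only [Prod.smul_fst, Prod.smul_snd, smul_eq_mul]
      rw [← mul_sub, abs_mul, abs_of_pos ht, Real.mul_rpow ht.le (abs_nonneg _)])
    (fun t ht z => by
      simp only [Prod.smul_fst, Prod.smul_snd, smul_eq_mul]
      rw [← mul_add, mul_div_assoc, abs_mul, abs_mul, abs_mul, abs_of_pos ht,
        Real.mul_rpow ht.le (abs_nonneg _), Real.mul_rpow ht.le (abs_nonneg _),
        Real.mul_rpow ht.le (abs_nonneg _)]
      ring)
    (fun z => by
      by_cases hz : z.1 = z.2
      · simp [hz]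
      · have := abs_midpoint_rpow_lt hp hz
        linarith)
    (fun z hz => by
      by_cases hz2 : z.1 = z.2
      · simp [hz2, Real.zero_rpow hp0.ne']
      · have := abs_midpoint_rpow_lt hp hz2
        linarith) hη
  exact ⟨C, hC, fun a b => h (a, b)⟩

/-- The left side vanishes when a = b, so compactness applies. Used to see that the density |f|^p is
almost invariant under a translation that moves f little in ℓ^p. -/
lemma exists_abs_rpow_sub_rpow_le (hp : 0 < p) {η : ℝ} (hη : 0 < η) :
    ∃ C : ℝ, 0 ≤ C ∧ ∀ a b : ℝ, |(|a| ^ p - |b| ^ p)| ≤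
      η * (|a| ^ p + |b| ^ p) + C * |a - b| ^ p := by
  obtain ⟨C, hC, h⟩ := exists_homogeneous_bound hp (P := fun z => |(|z.1| ^ p - |z.2| ^ p)|)
    (Q := fun z => |z.1 - z.2| ^ p)
    ((continuous_abs_rpow hp.le continuous_fst).sub
      (continuous_abs_rpow hp.le continuous_snd)).abs
    (continuous_abs_rpow hp.le (by fun_prop))
    (fun t ht z => by
      simp only [Prod.smul_fst, Prod.smul_snd, smul_eq_mul]
      rw [abs_mul, abs_mul, abs_of_pos ht, Real.mul_rpow ht.le (abs_nonneg _),
        Real.mul_rpow ht.le (abs_nonneg _), ← mul_sub, abs_mul,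
        abs_of_pos (Real.rpow_pos_of_pos ht p)])
    (fun t ht z => by
      simp only [Prod.smul_fst, Prod.smul_snd, smul_eq_mul]
      rw [← mul_sub, abs_mul, abs_of_pos ht, Real.mul_rpow ht.le (abs_nonneg _)])
    (fun z => by positivity)
    (fun z hz => by
      have h1 := (Real.rpow_eq_zero (abs_nonneg _) hp.ne').1 hz
      rw [abs_eq_zero, sub_eq_zero] at h1
      simp [h1]) hη
  exact ⟨C, hC, fun a b => h (a, b)⟩

/-- The tangent line inequality for `|·| ^ p`. -/
lemma abs_rpow_tangent_le (hp : 1 < p) (a b : ℝ) :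
    |a| ^ p + p * (|a| ^ (p - 2) * a) * (b - a) ≤ |b| ^ p := by
  have hd := hasDerivAt_abs_rpow a hp
  have hc := convexOn_abs_rpow hp.le
  rcases lt_trichotomy a b with h | h | h
  · have h1 := hc.le_slope_of_hasDerivAt (Set.mem_univ a) (Set.mem_univ b) h hd
    rw [slope_def_field, le_div_iff₀ (by linarith)] at h1
    linarith
  · simp [h]
  · have h1 := hc.slope_le_of_hasDerivAt (Set.mem_univ b) (Set.mem_univ a) h hd
    rw [slope_def_field, div_le_iff₀ (by linarith)] at h1
    linarith

end RealInequalities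

/-! ### p-harmonicity as energy minimality. -/

section Graph

variable {V : Type*} {G : SimpleGraph V} [G.LocallyFinite] {p : ℝ}

lemma support_edgeDiff_finite {g : V → ℝ} (hg : (Function.support g).Finite) :
    (Function.support (edgeDiff G g)).Finite := by
  classical
  set s := hg.toFinset
  refine (Finset.finite_toSet (s.biUnion fun x => (G.neighborFinset x).image fun y => (x, y)) |>.union
    (Finset.finite_toSet (s.biUnion fun x => (G.neighborFinset x).image fun y => (y, x)))).subset ?_
  rintro ⟨x, y⟩ h
  rw [Function.mem_support, edgeDiff] at h
  have hxy : G.Adj x y := by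
    by_contra hn
    simp [hn] at h
  rw [if_pos hxy] at h
  by_cases hx : g x = 0
  · right
    have hy : g y ≠ 0 := fun hy => h (by simp [hx, hy])
    simp [s, hy, hxy.symm]
  · left
    simp [s, hx, hxy]

/-- Summation by parts for the `p`-Laplacian. -/
lemma tsum_flux_mul_edgeDiff (h : V → ℝ) {g : V → ℝ} (hg : (Function.support g).Finite) :
    ∑' e, (|edgeDiff G h e| ^ (p - 2) * edgeDiff G h e) * edgeDiff G g e =
      -2 * ∑' x, g x * pLaplacian G p h x := by
  classical
  set φ : V × V → ℝ := fun e => |edgeDiff G h e| ^ (p - 2) * edgeDiff G h e with hφ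
  have hsupp : (Function.support fun e : V × V => φ e * g e.1).Finite := by
    refine (Finset.finite_toSet
      (hg.toFinset.biUnion fun x => (G.neighborFinset x).image fun y => (x, y))).subset ?_
    rintro ⟨x, y⟩ hxy
    rw [Function.mem_support] at hxy
    have hadj : G.Adj x y := by
      by_contra hn
      simp [hφ, edgeDiff, hn] at hxy
    have hgx : g x ≠ 0 := fun h0 => hxy (by simp [h0])
    simp [hgx, hadj]
  have hsum : Summable fun e : V × V => φ e * g e.1 := summable_of_hasFiniteSupport hsupp
  have hval : ∑' e : V × V, φ e * g e.1 = ∑' x, g x * pLaplacian G p h x := by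
    rw [hsum.tsum_prod]
    refine tsum_congr fun x => ?_
    rw [tsum_eq_sum (s := G.neighborFinset x), pLaplacian, Finset.mul_sum]
    · refine Finset.sum_congr rfl fun y hy => ?_
      rw [SimpleGraph.mem_neighborFinset] at hy
      simp only [hφ, edgeDiff, hy, if_true]; ring
    · intro y hy
      rw [SimpleGraph.mem_neighborFinset] at hy
      simp [hφ, edgeDiff, hy]
  -- The flux is odd under reversal of an edge, so the sums with g at the head and at the tail are
  -- opposite; this is the origin of the factor -2.
  have hanti : ∀ e, φ (Equiv.prodComm V V e) = -φ e := by
    rintro ⟨x, y⟩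
    simp only [hφ, edgeDiff, Equiv.prodComm_apply, Prod.swap_prod_mk, G.adj_comm y x]
    split_ifs
    · rw [abs_sub_comm]; ring
    · simp
  have hsum2 : HasSum (fun e : V × V => φ e * g e.2) (-∑' x, g x * pLaplacian G p h x) := by
    have h1 : HasSum (fun e : V × V => φ e * g e.1) (∑' x, g x * pLaplacian G p h x) :=
      hval ▸ hsum.hasSum
    rw [← (Equiv.prodComm V V).hasSum_iff]
    refine h1.neg.congr_fun ?_
    intro e
    simp only [Function.comp_apply, hanti]
    simp
  have hfin : HasSum (fun e : V × V => φ e * g e.2 - φ e * g e.1) _ := hsum2.sub (hval ▸ hsum.hasSum)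
  rw [show -2 * ∑' x, g x * pLaplacian G p h x = -∑' x, g x * pLaplacian G p h x -
    ∑' x, g x * pLaplacian G p h x by ring, ← hfin.tsum_eq]
  refine tsum_congr fun e => ?_
  simp only [hφ, edgeDiff]
  split_ifs
  · ring
  · simp

variable [hp : Fact (1 < p)]

/-- A `p`-harmonic function minimizes the Dirichlet sum under finitely supported perturbations. -/
lemma IsPHarmonic.dirichletSum_le {h k : V → ℝ} (hh : IsPHarmonic G p h)
    (hf : dirichletSum G p h < ∞) (hk : dirichletSum G p k < ∞)
    (hs : (Function.support fun x => k x - h x).Finite) :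
    (dirichletSum G p h).toReal ≤ (dirichletSum G p k).toReal := by
  have hp0 : p ≠ 0 := by linarith [hp.out]
  rw [toReal_dirichletSum hp0, toReal_dirichletSum hp0]
  have hsum : Summable fun e => p * ((|edgeDiff G h e| ^ (p - 2) * edgeDiff G h e) *
      edgeDiff G (fun x => k x - h x) e) := by
    refine summable_of_hasFiniteSupport ((support_edgeDiff_finite (G := G) hs).subset fun e he => ?_)
    rw [Function.mem_support] at he ⊢
    exact fun h0 => he (by rw [h0]; simp)
  -- The first-order term of the tangent inequality, summed over all edges, is a multiple of ∑ (k -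
  -- h) Δ_p h = 0.
  have hz : ∑' e, p * ((|edgeDiff G h e| ^ (p - 2) * edgeDiff G h e) *
      edgeDiff G (fun x => k x - h x) e) = 0 := by
    rw [tsum_mul_left, tsum_flux_mul_edgeDiff h hs]
    simp [hh _]
  have h1 := (summable_edgeDiff hp0 hf).tsum_add hsum
  rw [hz, add_zero] at h1
  rw [← h1]
  refine ((summable_edgeDiff hp0 hf).add hsum).tsum_le_tsum (fun e => ?_)
    (summable_edgeDiff hp0 hk)
  have h2 := abs_rpow_tangent_le hp.out (edgeDiff G h e) (edgeDiff G k e)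
  have h3 : edgeDiff G (fun x => k x - h x) e = edgeDiff G k e - edgeDiff G h e := by
    unfold edgeDiff; split_ifs <;> ring
  rw [h3]
  linarith

/-- A function minimizing the Dirichlet sum under finitely supported perturbations is
`p`-harmonic. -/
lemma isPHarmonic_of_dirichletSum_le {h : V → ℝ} (hf : dirichletSum G p h < ∞)
    (hmin : ∀ k : V → ℝ, dirichletSum G p k < ∞ → (Function.support fun x => k x - h x).Finite →
      (dirichletSum G p h).toReal ≤ (dirichletSum G p k).toReal) : IsPHarmonic G p h := by
  classical
  intro z
  have hp0 : 0 < p := by linarith [hp.out]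
  -- Perturbing by a point mass at z changes finitely many edges only, so the energy along h + t g
  -- differs from a differentiable finite sum by a constant; its derivative at t = 0 is a multiple
  -- of Δ_p h(z).
  set g : V → ℝ := Pi.single z 1 with hg
  have hgs : (Function.support g).Finite :=
    (Set.finite_singleton z).subset Pi.support_single_subset
  have hes := support_edgeDiff_finite (G := G) hgs
  set F := hes.toFinset with hF
  have hed : ∀ (t : ℝ) e, edgeDiff G (fun x => h x + t * g x) e =
      edgeDiff G h e + t * edgeDiff G g e := by
    intro t e; unfold edgeDiff; split_ifs <;> ring
  have hoff : ∀ e ∉ F, edgeDiff G g e = 0 := fun e he => by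
    simpa [hF] using he
  have hsum0 := summable_edgeDiff hp0.ne' hf
  have hsumt : ∀ t : ℝ, Summable fun e => |edgeDiff G h e + t * edgeDiff G g e| ^ p := fun t => by
    refine (summable_congr_cofinite ?_).2 hsum0
    rw [EventuallyEq, eventually_cofinite]
    refine F.finite_toSet.subset fun e he => ?_
    by_contra hn
    exact he (by simp [hoff e hn])
  have hψ : ∀ t : ℝ, ∑ e ∈ F, |edgeDiff G h e| ^ p ≤
      ∑ e ∈ F, |edgeDiff G h e + t * edgeDiff G g e| ^ p := by
    intro t
    have hfin : dirichletSum G p (fun x => h x + t * g x) < ∞ := by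
      rw [dirichletSum_eq_tsum_edgeDiff hp0.ne']
      simp only [hed]
      exact lt_top_iff_ne_top.2 (Summable.tsum_ofReal_ne_top (hsumt t))
    have h1 := hmin _ hfin (hgs.subset fun x hx => by
      rw [Function.mem_support] at hx ⊢
      exact fun h0 => hx (by simp [h0]))
    rw [toReal_dirichletSum hp0.ne', toReal_dirichletSum hp0.ne'] at h1
    simp only [hed] at h1
    rw [← hsum0.sum_add_tsum_compl (s := F), ← (hsumt t).sum_add_tsum_compl (s := F)] at h1
    have h2 : ∑' e : ↑((F : Set (V × V))ᶜ), |edgeDiff G h e + t * edgeDiff G g e| ^ p =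
        ∑' e : ↑((F : Set (V × V))ᶜ), |edgeDiff G h e| ^ p :=
      tsum_congr fun e => by rw [hoff e.1 e.2, mul_zero, add_zero]
    rw [h2] at h1
    linarith
  have hder : HasDerivAt (fun t : ℝ => ∑ e ∈ F, |edgeDiff G h e + t * edgeDiff G g e| ^ p)
      (∑ e ∈ F, p * |edgeDiff G h e| ^ (p - 2) * edgeDiff G h e * edgeDiff G g e) 0 := by
    refine HasDerivAt.fun_sum fun e _ => ?_
    have h1 : HasDerivAt (fun t : ℝ => edgeDiff G h e + t * edgeDiff G g e)
        (edgeDiff G g e) 0 := by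
      simpa using ((hasDerivAt_id (0 : ℝ)).mul_const (edgeDiff G g e)).const_add (edgeDiff G h e)
    have h2 := hasDerivAt_abs_rpow (edgeDiff G h e + 0 * edgeDiff G g e) hp.out
    have h3 := h2.comp (0 : ℝ) h1
    rw [zero_mul, add_zero] at h3
    exact h3
  have hloc : IsLocalMin (fun t : ℝ => ∑ e ∈ F, |edgeDiff G h e + t * edgeDiff G g e| ^ p) 0 :=
    Eventually.of_forall fun t => by simpa using hψ t
  have h0 := hloc.hasDerivAt_eq_zero hder
  have hparts := tsum_flux_mul_edgeDiff (G := G) (p := p) h hgs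
  rw [tsum_eq_sum (s := F) (fun e he => by rw [hoff e he, mul_zero]),
    tsum_eq_single z (fun x hx => by rw [hg, Pi.single_eq_of_ne hx, zero_mul])] at hparts
  have h4 : ∑ e ∈ F, p * |edgeDiff G h e| ^ (p - 2) * edgeDiff G h e * edgeDiff G g e =
      p * ∑ e ∈ F, |edgeDiff G h e| ^ (p - 2) * edgeDiff G h e * edgeDiff G g e := by
    rw [Finset.mul_sum]
    exact Finset.sum_congr rfl fun e _ => by ring
  rw [h4, hparts, hg, Pi.single_eq_same] at h0
  have : p * -2 ≠ 0 := by linarith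
  have h5 : p * -2 * pLaplacian G p h z = 0 := by linarith
  exact (mul_eq_zero.1 h5).resolve_left this

end Graph

/-! ### Truncation. -/

/-- Truncation of a real number to the interval `[-M, M]`. -/
def truncate (M t : ℝ) : ℝ := max (-M) (min t M)

lemma abs_truncate_sub_le (M a b : ℝ) : |truncate M a - truncate M b| ≤ |a - b| := by
  unfold truncate
  rw [max_comm (-M), max_comm (-M)]
  refine (abs_max_sub_max_le_abs _ _ _).trans ?_
  rw [min_comm a, min_comm b]
  have := abs_min_sub_min_le_max M a M b
  simpa using this

lemma abs_truncate_le {M : ℝ} (hM : 0 ≤ M) (t : ℝ) : |truncate M t| ≤ M := by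
  unfold truncate
  rw [abs_le]
  exact ⟨le_max_left _ _, max_le (by linarith) (min_le_right _ _)⟩

lemma truncate_of_abs_le {M t : ℝ} (h : |t| ≤ M) : truncate M t = t := by
  unfold truncate
  rw [abs_le] at h
  rw [min_eq_left h.2, max_eq_right h.1]

lemma continuous_truncate (M : ℝ) : Continuous (truncate M) := by
  unfold truncate; fun_prop

/-- Truncation is nondecreasing and 1-Lipschitz, hence so is the remainder t - truncate M t. This
bounds the differences of f minus its truncation by those of f. -/
lemma abs_sub_truncate_sub_le (M a b : ℝ) :
    |(a - truncate M a) - (b - truncate M b)| ≤ |a - b| := by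
  have h : ∀ c d : ℝ, c ≤ d → 0 ≤ truncate M d - truncate M c := by
    intro c d hcd
    unfold truncate
    exact sub_nonneg.2 (max_le_max le_rfl (min_le_min hcd le_rfl))
  have h1 := abs_truncate_sub_le M a b
  rcases le_total a b with hab | hab
  · have h2 := h a b hab
    rw [abs_of_nonpos (by linarith : truncate M a - truncate M b ≤ 0),
      abs_of_nonpos (by linarith : a - b ≤ 0)] at h1
    rw [abs_of_nonpos (by linarith), abs_of_nonpos (by linarith)]
    linarith
  · have h2 := h b a hab
    rw [abs_of_nonneg h2, abs_of_nonneg (by linarith : 0 ≤ a - b)] at h1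
    rw [abs_of_nonneg (by linarith), abs_of_nonneg (by linarith)]
    linarith

/-! ### The closure of the finitely supported functions and the Royden decomposition. -/

section Graph

variable {V : Type*} (G : SimpleGraph V) [G.LocallyFinite] (p : ℝ) [hp : Fact (1 < p)] (o : V)

/-- The subspace of finitely supported functions in `D_p(G)`. -/
def finSupp : Submodule ℝ (DirichletSpace G p o) where
  carrier := {g | (Function.support (g : V → ℝ)).Finite}
  add_mem' {f g} hf hg := (hf.union hg).subset (Function.support_add (f : V → ℝ) (g : V → ℝ))
  zero_mem' := by
    have : Function.support ((0 : DirichletSpace G p o) : V → ℝ) = ∅ :=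
      Function.support_eq_empty_iff.2 rfl
    simp [this]
  smul_mem' c f hf := hf.subset fun x hx h0 => hx (by simp [h0])

/-- The subspace of `D_p(G)` spanned by the constants and the closure of the finitely supported
functions. -/
def closureFinSuppSupConst : Submodule ℝ (DirichletSpace G p o) :=
  (finSupp G p o).topologicalClosure ⊔ constants G p o

variable {G p o}

lemma mem_finSupp {f : DirichletSpace G p o} :
    f ∈ finSupp G p o ↔ (Function.support (f : V → ℝ)).Finite := Iff.rfl

lemma constants_eq_span : constants G p o = Submodule.span ℝ
    {DirichletSpace.mk (fun _ => (1 : ℝ)) (by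
      rw [dirichletSum_const (by linarith [hp.out])]; exact ENNReal.zero_lt_top)} := by
  ext f
  rw [Submodule.mem_span_singleton]
  constructor
  · rintro ⟨c, hc⟩
    exact ⟨c, DirichletSpace.ext fun x => by simp [hc]⟩
  · rintro ⟨c, rfl⟩
    exact ⟨c, fun x => by simp⟩

instance : FiniteDimensional ℝ (constants G p o) := by
  rw [constants_eq_span]; infer_instance

/-- A closed subspace plus a finite-dimensional one is closed. -/
lemma isClosed_closureFinSuppSupConst :
    IsClosed (closureFinSuppSupConst G p o : Set (DirichletSpace G p o)) :=
  Submodule.isClosed_sup_finiteDimensional _ _ (Submodule.isClosed_topologicalClosure _)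

lemma dirichletSum_truncate_le (M : ℝ) (f : V → ℝ) :
    dirichletSum G p (fun x => truncate M (f x)) ≤ dirichletSum G p f :=
  dirichletSum_mono (by linarith [hp.out]) fun _ _ => abs_truncate_sub_le _ _ _

namespace DirichletSpace

/-- Truncation of an element of `D_p(G)` to values in `[-M, M]`. -/
def trunc (M : ℝ) (f : DirichletSpace G p o) : DirichletSpace G p o :=
  mk (fun x => truncate M (f x)) ((dirichletSum_truncate_le M _).trans_lt f.dirichletSum_lt_top)

@[simp] lemma trunc_apply (M : ℝ) (f : DirichletSpace G p o) (x : V) :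
    trunc M f x = truncate M (f x) := rfl

/-- Bounded functions are dense: at each vertex the truncation is eventually exact, and the
differences of the remainder are dominated by those of f. -/
lemma tendsto_trunc_atTop (f : DirichletSpace G p o) :
    Tendsto (fun n : ℕ => trunc n f) atTop (𝓝 f) := by
  have hp0 : 0 < p := by linarith [hp.out]
  have hev : ∀ x, ∀ᶠ n : ℕ in atTop, truncate n (f x) = f x := fun x => by
    filter_upwards [eventually_ge_atTop ⌈|f x|⌉₊] with n hn
    exact truncate_of_abs_le ((Nat.le_ceil _).trans (by exact_mod_cast hn))
  rw [tendsto_iff]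
  refine ⟨?_, tendsto_const_nhds.congr' ((hev o).mono fun n hn => by simp [hn])⟩
  refine tendsto_dirichletSum_zero hp0 (A := 0) (K := 1) (r := fun _ _ => 0) (f := f) le_rfl
    zero_le_one f.dirichletSum_lt_top (fun n x y => ?_) ?_ fun x => ?_
  · have := abs_sub_truncate_sub_le n (f x) (f y)
    rw [abs_sub_comm (f y)]
    simp only [trunc_apply, sub_zero, zero_mul, one_mul, zero_add]
    refine le_trans (le_of_eq (congrArg abs ?_)) this
    ring
  · simp [dirichletSum_const hp0.ne']
  · exact tendsto_const_nhds.congr' ((hev x).mono fun n hn => by simp [hn])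

/-- Shows that f is approximated by f - trunc ε f, which vanishes wherever |f| ≤ ε. -/
lemma tendsto_trunc_zero (f : DirichletSpace G p o) :
    Tendsto (fun ε : ℝ => trunc ε f) (𝓝[>] 0) (𝓝 0) := by
  have hp0 : 0 < p := by linarith [hp.out]
  have hx : ∀ x, Tendsto (fun ε : ℝ => truncate ε (f x)) (𝓝[>] 0) (𝓝 0) := fun x => by
    have h1 : Tendsto (fun ε : ℝ => ε) (𝓝[>] (0 : ℝ)) (𝓝 0) := nhdsWithin_le_nhds
    refine squeeze_zero_norm' ?_ h1
    filter_upwards [self_mem_nhdsWithin] with ε hε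
    exact abs_truncate_le (le_of_lt hε) _
  rw [tendsto_iff]
  refine ⟨?_, by simpa using hx o⟩
  refine tendsto_dirichletSum_zero hp0 (A := 0) (K := 1) (r := fun _ _ => 0) (f := f) le_rfl
    zero_le_one f.dirichletSum_lt_top (fun n x y => ?_) ?_ fun x => by simpa using hx x
  · simpa using abs_truncate_sub_le n (f y) (f x)
  · simp [dirichletSum_const hp0.ne']

/-- The differences of trunc M (u n) - trunc M f are not controlled by those of u n - f alone, but
they are at most |D(u n - f)| + 2|Df|, which is what generalized dominated convergence needs. -/
lemma tendsto_trunc (hG : G.Preconnected) (M : ℝ) {ι : Type*} {l : Filter ι}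
    {u : ι → DirichletSpace G p o} {f : DirichletSpace G p o} (h : Tendsto u l (𝓝 f)) :
    Tendsto (fun n => trunc M (u n)) l (𝓝 (trunc M f)) := by
  have hx : ∀ x, Tendsto (fun n => truncate M (u n x)) l (𝓝 (truncate M (f x))) := fun x =>
    ((continuous_truncate M).tendsto _).comp (tendsto_apply hG h x)
  refine tendsto_iff.2 ⟨?_, hx o⟩
  refine tendsto_dirichletSum_zero (by linarith [hp.out]) (A := 1) (K := 2)
    (r := fun n x => u n x - f x) (f := f) zero_le_one zero_le_two f.dirichletSum_lt_top
    (fun n x y => ?_) (tendsto_iff.1 h).1 fun x => by simpa using (hx x).sub_const (truncate M (f x))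
  simp only [trunc_apply, one_mul]
  have h1 := abs_truncate_sub_le M (u n y) (u n x)
  have h2 := abs_truncate_sub_le M (f y) (f x)
  have h3 : |u n y - u n x| ≤ |u n y - f y - (u n x - f x)| + |f y - f x| := by
    refine le_trans (le_of_eq (congrArg abs ?_)) (abs_add_le _ _); ring
  have h4 : |truncate M (u n y) - truncate M (f y) - (truncate M (u n x) - truncate M (f x))| ≤
      |truncate M (u n y) - truncate M (u n x)| + |truncate M (f y) - truncate M (f x)| := by
    refine le_trans (le_of_eq (congrArg abs ?_)) (abs_sub _ _); ring
  linarith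

/-- The energy is the p-th power of the norm of the class modulo constants. -/
lemma continuous_toReal_dirichletSum :
    Continuous fun f : DirichletSpace G p o => (dirichletSum G p f).toReal := by
  have hp0 : 0 < p := by linarith [hp.out]
  have h : (fun f : DirichletSpace G p o => (dirichletSum G p f).toReal) =
      fun f => ‖(constants G p o).mkQ f‖ ^ p := by
    funext f
    rw [norm_mkQ, ← Real.rpow_mul ENNReal.toReal_nonneg, one_div_mul_cancel hp0.ne',
      Real.rpow_one]
  rw [h]
  refine Continuous.rpow_const ?_ fun _ => Or.inr hp0.le
  exact continuous_norm.comp continuous_quot_mk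

/-- Uniform convexity of the Dirichlet sum. -/
lemma exists_toReal_dirichletSum_sub_le {η : ℝ} (hη : 0 < η) : ∃ C : ℝ, 0 ≤ C ∧
    ∀ f g : DirichletSpace G p o, (dirichletSum G p (f - g : DirichletSpace G p o)).toReal ≤
      η * ((dirichletSum G p f).toReal + (dirichletSum G p g).toReal) +
      C * (((dirichletSum G p f).toReal + (dirichletSum G p g).toReal) / 2 -
        (dirichletSum G p ((1 / 2 : ℝ) • (f + g) : DirichletSpace G p o)).toReal) := by
  have hp0 : p ≠ 0 := by linarith [hp.out]
  obtain ⟨C, hC, h⟩ := exists_abs_sub_rpow_le hp.out hη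
  refine ⟨C, hC, fun f g => ?_⟩
  have sf := (summable_edgeDiff hp0 f.dirichletSum_lt_top).hasSum
  have sg := (summable_edgeDiff hp0 g.dirichletSum_lt_top).hasSum
  have sm := (summable_edgeDiff hp0
    ((1 / 2 : ℝ) • (f + g) : DirichletSpace G p o).dirichletSum_lt_top).hasSum
  have sd := (summable_edgeDiff hp0 (f - g : DirichletSpace G p o).dirichletSum_lt_top).hasSum
  simp only [toReal_dirichletSum hp0]
  refine hasSum_le (fun e => ?_) sd (((sf.add sg).mul_left η).add
    ((((sf.add sg).div_const 2).sub sm).mul_left C))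
  have e1 : edgeDiff G (f - g : DirichletSpace G p o) e = edgeDiff G f e - edgeDiff G g e := by
    unfold edgeDiff; split_ifs
    · simp only [sub_apply]; ring
    · simp
  have e2 : edgeDiff G ((1 / 2 : ℝ) • (f + g) : DirichletSpace G p o) e =
      (edgeDiff G f e + edgeDiff G g e) / 2 := by
    unfold edgeDiff; split_ifs
    · simp only [smul_apply, add_apply]; ring
    · simp
  rw [e1, e2]
  exact h _ _

end DirichletSpace

open DirichletSpace

/-- The Royden decomposition of a bounded function: it differs from a bounded `p`-harmonic function
by a limit of finitely supported functions. -/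
lemma exists_bounded_isPHarmonic (f : DirichletSpace G p o) (hf : IsBdd (f : V → ℝ)) :
    ∃ h : DirichletSpace G p o, (h : V → ℝ) ∈ BHD G p ∧
      f - h ∈ (finSupp G p o).topologicalClosure := by
  have hp0 : 0 < p := by linarith [hp.out]
  obtain ⟨M, hM⟩ := hf
  have hM0 : 0 ≤ M := (abs_nonneg _).trans (hM o)
  set I : DirichletSpace G p o → ℝ := fun k => (dirichletSum G p k).toReal with hI
  set A : Set (DirichletSpace G p o) := {k | f - k ∈ finSupp G p o} with hA
  set m : ℝ := sInf (I '' A) with hm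
  have hbdd : BddBelow (I '' A) := ⟨0, by rintro _ ⟨k, _, rfl⟩; exact ENNReal.toReal_nonneg⟩
  have hne : (I '' A).Nonempty := ⟨I f, f, by simp [hA], rfl⟩
  have hmle : ∀ k ∈ A, m ≤ I k := fun k hk => csInf_le hbdd ⟨k, hk, rfl⟩
  have hm0 : 0 ≤ m := le_csInf hne (by rintro _ ⟨k, _, rfl⟩; exact ENNReal.toReal_nonneg)
  have hex : ∀ n : ℕ, ∃ k ∈ A, I k < m + 1 / (n + 1) ∧ ∀ x, |k x| ≤ M := by
    intro n
    obtain ⟨_, ⟨k, hk, rfl⟩, hlt⟩ := exists_lt_of_csInf_lt hne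
      (show m < m + 1 / ((n : ℝ) + 1) by linarith [Nat.one_div_pos_of_nat (α := ℝ) (n := n)])
    -- Truncating at the bound M of f does not raise the energy, and wherever k agrees with f
    -- nothing changes, so the competitor remains admissible.
    refine ⟨trunc M k, ?_, lt_of_le_of_lt ?_ hlt, fun x => abs_truncate_le hM0 _⟩
    · refine (mem_finSupp.1 hk).subset fun x hx h0 => hx ?_
      have h1 : k x = f x := by
        simp only [DirichletSpace.sub_apply] at h0; linarith
      simp [h1, truncate_of_abs_le (hM x)]
    · exact ENNReal.toReal_mono k.dirichletSum_lt_top.ne (dirichletSum_truncate_le M _)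
  choose k hkA hkI hkM using hex
  have hmid : ∀ n j, m ≤ I ((1 / 2 : ℝ) • (k n + k j)) := fun n j => by
    refine hmle _ ?_
    have h1 : f - (1 / 2 : ℝ) • (k n + k j) = (1 / 2 : ℝ) • ((f - k n) + (f - k j)) := by
      module
    rw [hA, Set.mem_ofPred_eq, h1]
    exact Submodule.smul_mem _ _ (Submodule.add_mem _ (hkA n) (hkA j))
  -- Midpoints are admissible, so their energy is at least m, and uniform convexity bounds I(k_n -
  -- k_j). Since I(k_n) + I(k_j) ≤ 2(m + 1), the choice η = ε/(4(m + 1)) makes the first term at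
  -- most ε/2; the convexity defect is at most 1/(N + 1), which N makes small against C. The added
  -- ones cover m = 0 and C = 0.
  have hcauchy : ∀ ε : ℝ, 0 < ε → ∃ N, ∀ n ≥ N, ∀ j ≥ N, I (k n - k j) ≤ ε := by
    intro ε hε
    obtain ⟨C, hC, h⟩ := exists_toReal_dirichletSum_sub_le (G := G) (p := p) (o := o)
      (show 0 < ε / (4 * (m + 1)) by positivity)
    obtain ⟨N, hN⟩ := exists_nat_one_div_lt (show 0 < ε / (2 * (C + 1)) by positivity)
    refine ⟨N, fun n hn j hj => (h _ _).trans ?_⟩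
    have hle : ∀ i ≥ N, I (k i) ≤ m + 1 / ((N : ℝ) + 1) := fun i hi =>
      (hkI i).le.trans (add_le_add le_rfl (Nat.one_div_le_one_div hi))
    have h1 := hle n hn
    have h2 := hle j hj
    have h3 := hmid n j
    have h4 : 1 / ((N : ℝ) + 1) ≤ 1 := by
      rw [div_le_one (by positivity)]; linarith [(Nat.cast_nonneg N : (0 : ℝ) ≤ N)]
    have h5 : ε / (4 * (m + 1)) * (I (k n) + I (k j)) ≤ ε / 2 := by
      calc _ ≤ ε / (4 * (m + 1)) * (2 * (m + 1)) :=
            mul_le_mul_of_nonneg_left (by linarith) (by positivity)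
        _ = ε / 2 := by field_simp; norm_num
    have h6 : C * ((I (k n) + I (k j)) / 2 - I ((1 / 2 : ℝ) • (k n + k j))) ≤ ε / 2 := by
      calc _ ≤ C * (1 / ((N : ℝ) + 1)) := mul_le_mul_of_nonneg_left (by linarith) hC
        _ ≤ (C + 1) * (1 / ((N : ℝ) + 1)) :=
            mul_le_mul_of_nonneg_right (by linarith) (by positivity)
        _ ≤ (C + 1) * (ε / (2 * (C + 1))) := mul_le_mul_of_nonneg_left hN.le (by linarith)
        _ = ε / 2 := by field_simp
    linarith
  -- An ultrafilter gives limits at all vertices at once, as the values lie in the compact interval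
  -- [-M, M].
  set U : Ultrafilter ℕ := hyperfilter ℕ
  have hUle : (U : Filter ℕ) ≤ atTop := by
    rw [← Nat.cofinite_eq_atTop]; exact hyperfilter_le_cofinite
  have hlim : ∀ x, ∃ c, |c| ≤ M ∧ Tendsto (fun n => k n x) U (𝓝 c) := fun x => by
    obtain ⟨c, hc, hc2⟩ := (isCompact_Icc (a := -M) (b := M)).ultrafilter_le_nhds
      (U.map fun n => k n x) 
        (show Tendsto (fun n => k n x) U (𝓟 (Set.Icc (-M) M)) from
          tendsto_principal.2 (Eventually.of_forall fun n => abs_le.1 (hkM n x)))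
    exact ⟨c, abs_le.2 hc, hc2⟩
  choose h hhM hh using hlim
  have hI_ofReal : ∀ (u : DirichletSpace G p o) (c : ℝ), I u ≤ c →
      dirichletSum G p u ≤ ENNReal.ofReal c := fun u c hc =>
    (ENNReal.le_ofReal_iff_toReal_le u.dirichletSum_lt_top.ne
      (ENNReal.toReal_nonneg.trans hc)).2 hc
  have hfin : dirichletSum G p h < ∞ := by
    refine lt_of_le_of_lt (dirichletSum_le_of_tendsto hp0 (l := (U : Filter ℕ)) hh
      (c := ENNReal.ofReal (m + 1)) (Eventually.of_forall fun n => hI_ofReal _ _ ?_))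
      ENNReal.ofReal_lt_top
    refine (hkI n).le.trans (add_le_add le_rfl ?_)
    rw [div_le_one (by positivity)]; linarith [(Nat.cast_nonneg n : (0 : ℝ) ≤ n)]
  set H : DirichletSpace G p o := mk h hfin with hH
  -- For fixed n, k_n - H is the pointwise limit of k_n - k_j, so lower semicontinuity turns the
  -- Cauchy estimate into convergence in energy.
  have hconv : Tendsto k U (𝓝 H) := by
    refine tendsto_iff.2 ⟨Tendsto.mono_left ?_ hUle, hh o⟩
    rw [ENNReal.tendsto_atTop_zero]
    intro ε hε
    obtain ⟨δ, hδ, hδε⟩ := ENNReal.lt_iff_exists_nnreal_btwn.1 hε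
    obtain ⟨N, hN⟩ := hcauchy δ (by exact_mod_cast hδ)
    refine ⟨N, fun n hn => le_trans ?_ hδε.le⟩
    refine dirichletSum_le_of_tendsto hp0 (l := (U : Filter ℕ))
      (u := fun j x => k n x - k j x) (fun x => tendsto_const_nhds.sub (hh x)) ?_
    filter_upwards [hUle (eventually_ge_atTop N)] with j hj
    have := hI_ofReal (k n - k j) δ (hN n hn j hj)
    rwa [ENNReal.ofReal_coe_nnreal] at this
  have hIH : I H ≤ m := by
    have h1 : Tendsto (fun n => I (k n)) U (𝓝 (I H)) :=
      (continuous_toReal_dirichletSum.tendsto H).comp hconv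
    have h2 : Tendsto (fun n : ℕ => m + 1 / ((n : ℝ) + 1)) U (𝓝 m) := by
      simpa using (tendsto_one_div_add_atTop_nhds_zero_nat.mono_left hUle).const_add m
    exact le_of_tendsto_of_tendsto' h1 h2 fun n => (hkI n).le
  refine ⟨H, ⟨⟨hfin, ?_⟩, M, hhM⟩, ?_⟩
  · refine isPHarmonic_of_dirichletSum_le hfin fun u hu hs => ?_
    refine hIH.trans ?_
    -- The limit H need not be admissible itself. But k_n + g is, so I(H + g) = lim I(k_n + g) ≥ m ≥
    -- I(H).
    set g : DirichletSpace G p o := mk u hu - H with hg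
    have h1 : Tendsto (fun n => I (k n + g)) U (𝓝 (I (H + g))) :=
      (continuous_toReal_dirichletSum.tendsto _).comp (hconv.add_const g)
    have h2 : H + g = mk u hu := by rw [hg]; abel
    rw [h2] at h1
    refine ge_of_tendsto' h1 fun n => hmle _ ?_
    have h3 : f - (k n + g) = (f - k n) - g := by abel
    rw [hA, Set.mem_ofPred_eq, h3]
    exact Submodule.sub_mem _ (hkA n) hs
  · rw [← SetLike.mem_coe, Submodule.topologicalClosure_coe]
    exact mem_closure_of_tendsto (hconv.const_sub f) (Eventually.of_forall hkA)

lemma closureFinSuppSupConst_eq_top_of_bounded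
    (h : ∀ f : DirichletSpace G p o, IsBdd (f : V → ℝ) → f ∈ closureFinSuppSupConst G p o) :
    closureFinSuppSupConst G p o = ⊤ := by
  rw [eq_top_iff]
  intro f _
  exact isClosed_closureFinSuppSupConst.mem_of_tendsto (tendsto_trunc_atTop f)
    (Eventually.of_forall fun n => h _ ⟨n, fun x => abs_truncate_le n.cast_nonneg _⟩)

lemma closureFinSuppSupConst_eq_top_of_BHD (h : BHD G p = constFun V) :
    closureFinSuppSupConst G p o = ⊤ := by
  refine closureFinSuppSupConst_eq_top_of_bounded fun f hf => ?_
  obtain ⟨k, hk, hfk⟩ := exists_bounded_isPHarmonic f hf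
  rw [h] at hk
  obtain ⟨c, hc⟩ := hk
  have hkc : k ∈ constants G p o := ⟨c, fun x => (congrFun hc x).symm⟩
  rw [← sub_add_cancel f k]
  exact Submodule.add_mem_sup hfk hkc

lemma constFun_subset_BHD : constFun V ⊆ BHD G p := by
  rintro _ ⟨c, rfl⟩
  refine ⟨⟨?_, fun x => by simp [pLaplacian]⟩, |c|, fun _ => le_rfl⟩
  rw [dirichletSum_const (by linarith [hp.out])]; exact ENNReal.zero_lt_top

/-- Minimality under finitely supported perturbations passes to their closure by continuity of the
energy. Writing -f = g + c makes f + g constant, so the energy of f is at most 0. -/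
lemma HD_eq_constFun (hG : G.Preconnected) (h : closureFinSuppSupConst G p o = ⊤) :
    HD G p = constFun V := by
  refine Set.Subset.antisymm (fun f hf => ?_) fun f hf => (constFun_subset_BHD hf).1
  have hp0 : 0 < p := by linarith [hp.out]
  set H : DirichletSpace G p o := mk f hf.1 with hH
  have hmin : ∀ g ∈ finSupp G p o, (dirichletSum G p H).toReal ≤
      (dirichletSum G p (H + g : DirichletSpace G p o)).toReal := fun g hg => by
    refine IsPHarmonic.dirichletSum_le hf.2 hf.1 (H + g).dirichletSum_lt_top ?_
    refine hg.subset fun x hx h0 => hx ?_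
    change f x + g x - f x = 0
    rw [h0]; ring
  have hmin' : ∀ g ∈ (finSupp G p o).topologicalClosure, (dirichletSum G p H).toReal ≤
      (dirichletSum G p (H + g : DirichletSpace G p o)).toReal := fun g hg => by
    rw [← SetLike.mem_coe, Submodule.topologicalClosure_coe] at hg
    refine closure_minimal (t := {g | (dirichletSum G p H).toReal ≤
      (dirichletSum G p (H + g : DirichletSpace G p o)).toReal}) hmin ?_ hg
    exact isClosed_le continuous_const
      (continuous_toReal_dirichletSum.comp (continuous_const.add continuous_id))
  have hmem : -H ∈ closureFinSuppSupConst G p o := h ▸ Submodule.mem_top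
  obtain ⟨g, hg, c, ⟨c', hc⟩, hgc⟩ := Submodule.mem_sup.1 hmem
  have h1 := hmin' g hg
  have h2 : ((H + g : DirichletSpace G p o) : V → ℝ) = fun _ => -c' := by
    funext x
    have h3 : (g + c : DirichletSpace G p o) x = -f x := by rw [hgc]; rfl
    rw [DirichletSpace.add_apply, hc] at h3
    change f x + g x = -c'
    linarith
  rw [h2, dirichletSum_const hp0.ne', ENNReal.toReal_zero] at h1
  have h4 : dirichletSum G p f = 0 := by
    have h5 := le_antisymm h1 ENNReal.toReal_nonneg
    exact ((ENNReal.toReal_eq_zero_iff _).1 h5).resolve_right hf.1.ne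
  exact ⟨f o, funext fun x => eq_of_dirichletSum_eq_zero hG hp0 h4 o x⟩

end Graph

/-! ### The p-harmonic boundary through ideals, filters and ultrafilters. -/

section Boundary

open DirichletSpace

variable {V : Type*} {G : SimpleGraph V} [G.LocallyFinite] {p : ℝ} [hp : Fact (1 < p)] {o : V}

/-- Approximants of g are truncated at a bound of g, which keeps them finitely supported and makes
them uniformly bounded. The Leibniz rule then bounds the differences of the product error by B|D(v_n
- g)| + 2M|Df|. -/
lemma mul_mem_closure_finSupp (hG : G.Preconnected) (f g : BD G p)
    (hg : mk g.1 g.2.1 ∈ (finSupp G p o).topologicalClosure) :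
    mk (f * g).1 (f * g).2.1 ∈ (finSupp G p o).topologicalClosure := by
  obtain ⟨B, hB⟩ := f.2.2
  obtain ⟨M, hM⟩ := g.2.2
  have hB0 : 0 ≤ B := (abs_nonneg _).trans (hB o)
  have hM0 : 0 ≤ M := (abs_nonneg _).trans (hM o)
  rw [← SetLike.mem_coe, Submodule.topologicalClosure_coe, mem_closure_iff_seq_limit] at hg ⊢
  obtain ⟨u, hu, hlim⟩ := hg
  set v : ℕ → BD G p := fun n =>
    ⟨trunc M (u n), (trunc M (u n)).dirichletSum_lt_top, M, fun x => abs_truncate_le hM0 _⟩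
    with hv
  have hvlim : Tendsto (fun n => (mk (v n).1 (v n).2.1 : DirichletSpace G p o)) atTop
      (𝓝 (mk g.1 g.2.1)) := by
    have h1 := tendsto_trunc hG M hlim
    have h2 : trunc M (mk g.1 g.2.1 : DirichletSpace G p o) = mk g.1 g.2.1 :=
      DirichletSpace.ext fun x => truncate_of_abs_le (hM x)
    rw [h2] at h1
    exact h1
  refine ⟨fun n => mk (f * v n).1 (f * v n).2.1, fun n => ?_, tendsto_iff.2 ⟨?_, ?_⟩⟩
  · refine (mem_finSupp.1 (hu n)).subset fun x hx h0 => hx ?_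
    change f.1 x * truncate M (u n x) = 0
    rw [h0, truncate_of_abs_le (by simpa using hM0), mul_zero]
  · refine tendsto_dirichletSum_zero (by linarith [hp.out]) (A := B) (K := 2 * M)
      (r := fun n x => (v n).1 x - g.1 x) (f := f.1) hB0 (by positivity) f.2.1
      (fun n x y => ?_) (tendsto_iff.1 hvlim).1 fun x => ?_
    · change |f.1 y * (v n).1 y - f.1 y * g.1 y - (f.1 x * (v n).1 x - f.1 x * g.1 x)| ≤ _
      have e : f.1 y * (v n).1 y - f.1 y * g.1 y - (f.1 x * (v n).1 x - f.1 x * g.1 x) =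
        f.1 y * ((v n).1 y - g.1 y - ((v n).1 x - g.1 x)) +
          ((v n).1 x - g.1 x) * (f.1 y - f.1 x) := by ring
      rw [e]
      refine (abs_add_le _ _).trans ?_
      rw [abs_mul, abs_mul]
      have h1 : |(v n).1 x - g.1 x| ≤ 2 * M := by
        have h2 : |(v n).1 x| ≤ M := abs_truncate_le hM0 _
        linarith [abs_sub (v n |>.1 x) (g.1 x), hM x]
      gcongr
      exact hB y
    · have h1 := (tendsto_apply hG hvlim x).const_mul (f.1 x)
      simpa using h1.sub_const (f.1 x * g.1 x)
  · exact (tendsto_apply hG hvlim o).const_mul (f.1 o)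

/-- The ideal of `BD_p(G)` of the functions in the closure of the finitely supported functions. -/
def boundedClosureIdeal (hG : G.Preconnected) (o : V) : Ideal (BD G p) where
  carrier := boundedClosureFinSupp G p o
  add_mem' {f g} hf hg := (finSupp G p o).topologicalClosure.add_mem
    (x := mk f.1 f.2.1) (y := mk g.1 g.2.1) hf hg
  zero_mem' := (finSupp G p o).topologicalClosure.zero_mem
  smul_mem' f g hg := mul_mem_closure_finSupp hG f g hg

/-- The filter of the sets off which some function of the ideal is at least `1`. -/
def idealFilter (I : Ideal (BD G p)) : Filter V where
  sets := {A | ∃ g ∈ I, (∀ x, 0 ≤ g.1 x) ∧ ∀ x ∉ A, 1 ≤ g.1 x}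
  univ_sets := ⟨0, I.zero_mem, fun _ => le_rfl, fun x hx => absurd (Set.mem_univ x) hx⟩
  sets_of_superset := by
    rintro A B ⟨g, hg, h0, h1⟩ hAB
    exact ⟨g, hg, h0, fun x hx => h1 x fun h => hx (hAB h)⟩
  inter_sets := by
    rintro A B ⟨g, hg, h0, h1⟩ ⟨k, hk, h2, h3⟩
    refine ⟨g + k, I.add_mem hg hk, fun x => add_nonneg (h0 x) (h2 x), fun x hx => ?_⟩
    change 1 ≤ g.1 x + k.1 x
    by_cases hA : x ∈ A
    · have := h3 x fun hB => hx ⟨hA, hB⟩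
      linarith [h0 x]
    · have := h1 x hA
      linarith [h2 x]

/-- The function t ↦ 1/max(t, δ) is Lipschitz with constant δ^(-2). -/
lemma dirichletSum_inv_max_lt_top {k : V → ℝ} (hk : dirichletSum G p k < ∞) {δ : ℝ} (hδ : 0 < δ) :
    dirichletSum G p (fun x => (max (k x) δ)⁻¹) < ∞ := by
  refine dirichletSum_lt_top_of_le (a := δ⁻¹ * δ⁻¹) (b := 0) (by linarith [hp.out])
    (by positivity) le_rfl (fun x y => ?_) hk hk
  have hx : δ ≤ max (k x) δ := le_max_right _ _
  have hy : δ ≤ max (k y) δ := le_max_right _ _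
  rw [inv_sub_inv (by linarith) (by linarith), abs_div, zero_mul, add_zero, abs_mul,
    abs_of_pos (hδ.trans_le hx), abs_of_pos (hδ.trans_le hy), div_eq_inv_mul, mul_inv]
  have h1 : |max (k x) δ - max (k y) δ| ≤ |k y - k x| := by
    rw [abs_sub_comm]; exact abs_max_sub_max_le_abs _ _ _
  gcongr

/-- The function `1 / max(k, δ)` in `BD_p(G)`. -/
def invMax (k : BD G p) {δ : ℝ} (hδ : 0 < δ) : BD G p :=
  ⟨fun x => (max (k.1 x) δ)⁻¹, dirichletSum_inv_max_lt_top k.2.1 hδ, δ⁻¹, fun x => by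
    have hx : δ ≤ max (k.1 x) δ := le_max_right _ _
    rw [abs_of_pos (inv_pos.2 (hδ.trans_le hx))]
    exact inv_anti₀ hδ hx⟩

/-- A trivial filter would give some g in the ideal with g ≥ 1 everywhere, which is invertible in
BD_p with inverse `invMax g`. -/
lemma idealFilter_neBot {I : Ideal (BD G p)} (hI : (1 : BD G p) ∉ I) : (idealFilter I).NeBot := by
  refine ⟨fun hbot => hI ?_⟩
  have h : (∅ : Set V) ∈ idealFilter I := by rw [hbot]; exact mem_bot
  obtain ⟨g, hg, -, h1⟩ := h
  have e : (1 : BD G p) = invMax g one_pos * g := by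
    refine Subtype.ext (funext fun x => ?_)
    change 1 = (max (g.1 x) 1)⁻¹ * g.1 x
    rw [max_eq_left (h1 x id), inv_mul_cancel₀]
    linarith [h1 x id]
  rw [e]
  exact I.mul_mem_left _ hg

lemma tendsto_idealFilter {I : Ideal (BD G p)} {g : BD G p} (hg : g ∈ I) :
    Tendsto g.1 (idealFilter I) (𝓝 0) := by
  rw [Metric.tendsto_nhds]
  intro ε hε
  -- The witness g²/ε² is nonnegative, lies in the ideal and is at least 1 where |g| ≥ ε.
  refine ⟨algebraMap ℝ (BD G p) (ε⁻¹ ^ 2) * (g * g), I.mul_mem_left _ (I.mul_mem_left _ hg),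
    fun x => ?_, fun x hx => ?_⟩
  · change 0 ≤ ε⁻¹ ^ 2 * (g.1 x * g.1 x)
    nlinarith [mul_self_nonneg (g.1 x), sq_nonneg ε⁻¹]
  · change 1 ≤ ε⁻¹ ^ 2 * (g.1 x * g.1 x)
    have h1 : ε ≤ |g.1 x| := by
      simpa [Set.mem_ofPred_eq, Real.dist_eq] using hx
    have h2 : ε ^ 2 ≤ g.1 x * g.1 x := by
      rw [← abs_mul_abs_self, ← sq]; gcongr
    calc (1 : ℝ) = ε⁻¹ ^ 2 * ε ^ 2 := by field_simp
      _ ≤ _ := mul_le_mul_of_nonneg_left h2 (by positivity)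

lemma exists_ultrafilter_limit (U : Ultrafilter V) (f : BD G p) :
    ∃ c : ℝ, Tendsto f.1 U (𝓝 c) := by
  obtain ⟨M, hM⟩ := f.2.2
  obtain ⟨c, -, hc⟩ := (isCompact_Icc (a := -M) (b := M)).ultrafilter_le_nhds (U.map f.1)
    (show Tendsto f.1 U (𝓟 (Set.Icc (-M) M)) from
      tendsto_principal.2 (Eventually.of_forall fun x => abs_le.1 (hM x)))
  exact ⟨c, hc⟩

/-- The limit of a function in `BD_p(G)` along an ultrafilter. -/
def ultraLimit (U : Ultrafilter V) (f : BD G p) : ℝ := (exists_ultrafilter_limit U f).choose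

lemma tendsto_ultraLimit (U : Ultrafilter V) (f : BD G p) :
    Tendsto f.1 U (𝓝 (ultraLimit U f)) := (exists_ultrafilter_limit U f).choose_spec

lemma ultraLimit_eq {U : Ultrafilter V} {f : BD G p} {c : ℝ} (h : Tendsto f.1 U (𝓝 c)) :
    ultraLimit U f = c := tendsto_nhds_unique (tendsto_ultraLimit U f) h

/-- The character of `BD_p(G)` given by the limit along an ultrafilter. -/
def ultraChar (U : Ultrafilter V) : Spectrum G p :=
  (Algebra.ofId ℝ ℂ).comp
    { toFun := ultraLimit U
      map_one' := ultraLimit_eq tendsto_const_nhds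
      map_zero' := ultraLimit_eq tendsto_const_nhds
      map_mul' := fun f g => ultraLimit_eq ((tendsto_ultraLimit U f).mul (tendsto_ultraLimit U g))
      map_add' := fun f g => ultraLimit_eq ((tendsto_ultraLimit U f).add (tendsto_ultraLimit U g))
      commutes' := fun _ => ultraLimit_eq tendsto_const_nhds }

lemma ultraChar_apply (U : Ultrafilter V) (f : BD G p) :
    ultraChar U f = (ultraLimit U f : ℂ) := rfl

lemma dirichletSum_lt_top_of_finite {g : V → ℝ} (hg : (Function.support g).Finite) :
    dirichletSum G p g < ∞ := by
  have hp0 : p ≠ 0 := by linarith [hp.out]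
  rw [dirichletSum_eq_tsum_edgeDiff hp0, lt_top_iff_ne_top]
  refine Summable.tsum_ofReal_ne_top (summable_of_hasFiniteSupport ?_)
  refine (support_edgeDiff_finite (G := G) hg).subset fun e he h0 => ?_
  rw [Function.mem_support] at he
  exact he (by simp [h0, Real.zero_rpow hp0])

lemma finite_support_single [DecidableEq V] (x : V) (c : ℝ) :
    (Function.support (Pi.single x c : V → ℝ)).Finite :=
  (Set.finite_singleton x).subset Pi.support_single_subset

/-- Not being an evaluation is automatic: the point mass at x is in the ideal, and evaluation at x
sends it to 1. -/
lemma mem_harmonicBoundary {τ : Spectrum G p} :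
    τ ∈ harmonicBoundary G p o ↔ ∀ f ∈ boundedClosureFinSupp G p o, τ f = 0 := by
  classical
  refine ⟨fun h => h.2, fun h => ⟨?_, h⟩⟩
  rintro ⟨x, rfl⟩
  have hb : IsBdd (Pi.single x (1 : ℝ) : V → ℝ) := ⟨1, fun y => by
    by_cases hy : y = x
    · simp [hy]
    · simp [Pi.single_eq_of_ne hy]⟩
  set δ : BD G p := ⟨Pi.single x 1, dirichletSum_lt_top_of_finite (finite_support_single x 1), hb⟩ with hδ
  have h1 : evalChar x δ = 0 := h δ (subset_closure (finite_support_single x 1))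
  have h2 : evalChar x δ = ((δ.1 x : ℝ) : ℂ) := rfl
  rw [h2, hδ] at h1
  simp at h1

/-- Each f in BD_p is a constant c plus an element of the ideal, and c does not depend on the
character. -/
lemma harmonicBoundary_of_eq_top (h : closureFinSuppSupConst G p o = ⊤) :
    harmonicBoundary G p o = ∅ ∨ (harmonicBoundary G p o).ncard = 1 := by
  have hsub : (harmonicBoundary G p o).Subsingleton := by
    have key : ∀ τ ∈ harmonicBoundary G p o, ∀ (f : BD G p) (c : ℝ),
        f - algebraMap ℝ _ c ∈ boundedClosureFinSupp G p o → τ f = c := by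
      intro τ hτ f c hc
      have h1 := hτ.2 _ hc
      rw [map_sub, AlgHom.commutes, sub_eq_zero] at h1
      exact h1
    intro τ hτ σ hσ
    refine AlgHom.ext fun f => ?_
    have hmem : (mk f.1 f.2.1 : DirichletSpace G p o) ∈ closureFinSuppSupConst G p o :=
      h ▸ Submodule.mem_top
    obtain ⟨g, hg, k, ⟨c, hc⟩, hgk⟩ := Submodule.mem_sup.1 hmem
    have h1 : f - algebraMap ℝ _ c ∈ boundedClosureFinSupp G p o := by
      have h2 : (mk (f - algebraMap ℝ _ c).1 (f - algebraMap ℝ _ c).2.1 : DirichletSpace G p o) =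
          g := by
        refine DirichletSpace.ext fun x => ?_
        change f.1 x - c = g x
        have h3 : (g + k : DirichletSpace G p o) x = f.1 x := by rw [hgk]; rfl
        rw [DirichletSpace.add_apply, hc] at h3
        linarith
      change DirichletSpace.mk _ _ ∈ (finSupp G p o).topologicalClosure
      rwa [h2]
    rw [key τ hτ f c h1, key σ hσ f c h1]
  rcases hsub.eq_empty_or_singleton with h | ⟨τ, h⟩
  · exact Or.inl h
  · exact Or.inr (by rw [h, Set.ncard_singleton])

/-- If 1 is in the ideal, every bounded function is in the closure. Otherwise the filter is proper,
an ultrafilter above it yields a boundary point, and uniqueness of that point makes f converge along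
the filter. -/
lemma eq_top_of_harmonicBoundary (hG : G.Preconnected)
    (h : harmonicBoundary G p o = ∅ ∨ (harmonicBoundary G p o).ncard = 1) :
    closureFinSuppSupConst G p o = ⊤ := by
  refine closureFinSuppSupConst_eq_top_of_bounded fun f hf => ?_
  set I := boundedClosureIdeal (p := p) hG o with hI
  set F : BD G p := ⟨f, f.dirichletSum_lt_top, hf⟩ with hF
  by_cases h1 : (1 : BD G p) ∈ I
  · have h2 : F ∈ I := by
      rw [(Ideal.eq_top_iff_one I).2 h1]; exact Submodule.mem_top
    exact Submodule.mem_sup_left h2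
  · have hne := idealFilter_neBot h1
    have hchar : ∀ U : Ultrafilter V, (U : Filter V) ≤ idealFilter I →
        ultraChar U ∈ harmonicBoundary G p o := fun U hU =>
      mem_harmonicBoundary.2 fun g hg => by
        rw [ultraChar_apply, ultraLimit_eq ((tendsto_idealFilter (I := I) hg).mono_left hU),
          Complex.ofReal_zero]
    have h2 : ∃ τ, harmonicBoundary G p o = {τ} := by
      rcases h with h | h
      · have := hchar (Ultrafilter.of (idealFilter I)) (Ultrafilter.of_le _)
        rw [h] at this
        exact absurd this (Set.notMem_empty _)
      · exact Set.ncard_eq_one.1 h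
    obtain ⟨τ, hτ⟩ := h2
    set c : ℝ := ultraLimit (Ultrafilter.of (idealFilter I)) F with hc
    have hlim : Tendsto F.1 (idealFilter I) (𝓝 c) := by
      -- All ultrafilters above the filter define the same character, so f has the same limit along
      -- each of them.
      rw [tendsto_iff_ultrafilter]
      intro U hU
      have e1 := hchar U hU
      have e2 := hchar (Ultrafilter.of (idealFilter I)) (Ultrafilter.of_le _)
      rw [hτ, Set.mem_singleton_iff] at e1 e2
      have e3 : ultraChar U F = ultraChar (Ultrafilter.of (idealFilter I)) F := by rw [e1, e2]
      rw [ultraChar_apply, ultraChar_apply, Complex.ofReal_inj] at e3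
      rw [hc, ← e3]
      exact tendsto_ultraLimit U F
    set k : DirichletSpace G p o := mk (fun _ => c) (by
      rw [dirichletSum_const (by linarith [hp.out])]; exact ENNReal.zero_lt_top) with hk
    have hkc : k ∈ constants G p o := ⟨c, fun _ => rfl⟩
    rw [← sub_add_cancel f k]
    refine Submodule.add_mem_sup ?_ hkc
    have h0 : Tendsto (fun ε : ℝ => (f - k) - trunc ε (f - k)) (𝓝[>] 0) (𝓝 (f - k)) := by
      simpa using (tendsto_trunc_zero (f - k)).const_sub (f - k)
    refine (Submodule.isClosed_topologicalClosure _).mem_of_tendsto h0 ?_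
    filter_upwards [self_mem_nhdsWithin] with ε (hε : 0 < ε)
    have hev : ∀ᶠ x in idealFilter I, |f x - c| < ε := by
      have := Metric.tendsto_nhds.1 hlim ε hε
      simpa only [Real.dist_eq] using this
    obtain ⟨g, hg, hg0, hg1⟩ := hev
    obtain ⟨M, hM⟩ := hf
    set w : BD G p := ⟨((f - k) - trunc ε (f - k) : DirichletSpace G p o),
      DirichletSpace.dirichletSum_lt_top _, M + |c| + ε, fun x => by
        have h1 := abs_truncate_le hε.le (f x - c)
        change |f x - c - truncate ε (f x - c)| ≤ _
        have h2 := abs_sub (f x - c) (truncate ε (f x - c))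
        have h3 := abs_sub (f x) c
        linarith [hM x]⟩ with hw
    -- Where |f - c| < ε the function w vanishes; elsewhere g ≥ 1 and `invMax g` is exactly 1/g.
    have hw2 : w = (w * invMax g one_pos) * g := by
      refine Subtype.ext (funext fun x => ?_)
      change w.1 x = w.1 x * (max (g.1 x) 1)⁻¹ * g.1 x
      by_cases hx : |f x - c| < ε
      · have : w.1 x = 0 := by
          change f x - c - truncate ε (f x - c) = 0
          rw [truncate_of_abs_le hx.le, sub_self]
        rw [this]; ring
      · have h3 := hg1 x hx
        rw [max_eq_left h3, mul_assoc, inv_mul_cancel₀ (by linarith), mul_one]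
    have hwI : w ∈ I := hw2 ▸ I.mul_mem_left _ hg
    exact hwI

end Boundary

open DirichletSpace

/-! ### Cayley graphs: ℓ^p inside D_p, translations and continuous TILFs. -/

section Cayley

variable {Γ : Type*} [Group Γ] {S : Finset Γ} {p : ℝ}

lemma cayley_preconnected (hS : Subgroup.closure (S : Set Γ) = ⊤) : (cayley S).Preconnected := by
  have key : ∀ g x : Γ, (cayley S).Reachable x (x * g) := by
    intro g
    have hg : g ∈ Subgroup.closure (S : Set Γ) := hS ▸ Subgroup.mem_top g
    induction hg using Subgroup.closure_induction with
    | mem s hs =>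
      intro x
      by_cases h : x = x * s
      · rw [← h]
      · refine SimpleGraph.Adj.reachable ?_
        rw [SimpleGraph.mulCayley_adj]
        exact ⟨h, Or.inl (by simpa using hs)⟩
    | one => intro x; rw [mul_one]
    | mul t u _ _ ht hu => intro x; rw [← mul_assoc]; exact (ht x).trans (hu _)
    | inv t _ ht => intro x; simpa using (ht (x * t⁻¹)).symm
  intro x y
  simpa using key (x⁻¹ * y) x

lemma shiftSum_le (hp : 0 ≤ p) (w : Γ → ℝ) (t : Γ) :
    shiftSum p w t ≤ ENNReal.ofReal (2 ^ p) * 2 * ∑' x, ENNReal.ofReal (|w x| ^ p) := by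
  have h1 : ∑' x, ENNReal.ofReal (|w (x * t)| ^ p) = ∑' x, ENNReal.ofReal (|w x| ^ p) :=
    (Equiv.mulRight t).tsum_eq fun x => ENNReal.ofReal (|w x| ^ p)
  calc shiftSum p w t ≤ ∑' x, ENNReal.ofReal (2 ^ p) *
        (ENNReal.ofReal (|w (x * t)| ^ p) + ENNReal.ofReal (|w x| ^ p)) := by
        refine ENNReal.tsum_le_tsum fun x => ?_
        rw [← ENNReal.ofReal_add (by positivity) (by positivity),
          ← ENNReal.ofReal_mul (by positivity)]
        exact ENNReal.ofReal_le_ofReal ((Real.rpow_le_rpow (abs_nonneg _) (abs_sub _ _) hp).trans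
          (add_rpow_bound hp (abs_nonneg _) (abs_nonneg _)))
    _ = _ := by rw [ENNReal.tsum_mul_left, ENNReal.tsum_add, h1, mul_assoc, two_mul]

/-- Bounded degree: the energy is a sum of boundedly many shift sums, each at most a constant
multiple of the p-th power of the ℓ^p-norm. -/
lemma exists_dirichletSum_le_tsum (S : Finset Γ) (hp : 0 < p) : ∃ K : ℝ≥0∞, K ≠ ∞ ∧ ∀ w : Γ → ℝ,
    dirichletSum (cayley S) p w ≤ K * ∑' x, ENNReal.ofReal (|w x| ^ p) := by
  classical
  refine ⟨(S ∪ S⁻¹).card * (ENNReal.ofReal (2 ^ p) * 2), ?_, fun w => ?_⟩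
  · exact ENNReal.mul_ne_top (ENNReal.natCast_ne_top _)
      (ENNReal.mul_ne_top ENNReal.ofReal_ne_top ENNReal.ofNat_ne_top)
  · rw [dirichletSum_eq_sum_shiftSum S hp.ne', mul_assoc, ← nsmul_eq_mul]
    exact Finset.sum_le_card_nsmul _ _ _ fun t _ => shiftSum_le hp.le w t

lemma dirichletSum_lt_top_of_summable (hp : 0 < p) {w : Γ → ℝ}
    (hw : Summable fun x => |w x| ^ p) : dirichletSum (cayley S) p w < ∞ := by
  obtain ⟨K, hK, h⟩ := exists_dirichletSum_le_tsum S hp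
  exact (h w).trans_lt (ENNReal.mul_lt_top hK.lt_top hw.tsum_ofReal_lt_top)

variable [hp : Fact (1 < p)]

/-- Restrictions to growing finite sets converge in ℓ^p, hence in energy, and are exact at the
identity once it belongs to the set. -/
lemma ellp_le_closure_finSupp :
    ellp (cayley S) p (1 : Γ) ≤ (finSupp (cayley S) p 1).topologicalClosure := by
  classical
  intro f hf
  have hp0 : 0 < p := by linarith [hp.out]
  set u : Finset Γ → DirichletSpace (cayley S) p (1 : Γ) := fun F =>
    mk ((F : Set Γ).indicator f) (dirichletSum_lt_top_of_finite
      (F.finite_toSet.subset Set.support_indicator_subset)) with hu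
  have hmem : ∀ F, u F ∈ finSupp (cayley S) p 1 := fun F =>
    F.finite_toSet.subset Set.support_indicator_subset
  refine mem_closure_of_tendsto (b := atTop) (f := u) (tendsto_iff.2 ⟨?_, ?_⟩)
    (Eventually.of_forall hmem)
  · obtain ⟨K, hK, h⟩ := exists_dirichletSum_le_tsum S hp0
    have hle : ∀ F : Finset Γ, dirichletSum (cayley S) p (fun x => u F x - f x) ≤
        K * ∑' x : {x // x ∉ F}, ENNReal.ofReal (|f x| ^ p) := fun F => by
      refine (h _).trans (le_of_eq ?_)
      congr 1
      refine Eq.trans ?_ (tsum_subtype {x | x ∉ F} fun x => ENNReal.ofReal (|f x| ^ p)).symm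
      refine tsum_congr fun x => ?_
      by_cases hx : x ∈ F
      · simp [hu, hx, Real.zero_rpow hp0.ne']
      · simp [hu, hx]
    have ht := ENNReal.Tendsto.const_mul (a := K) (ENNReal.tendsto_tsum_compl_atTop_zero
      (Summable.tsum_ofReal_lt_top hf).ne) (Or.inr hK)
    rw [mul_zero] at ht
    exact tendsto_of_tendsto_of_tendsto_of_le_of_le tendsto_const_nhds ht (fun _ => zero_le) hle
  · refine tendsto_const_nhds.congr' ?_
    filter_upwards [eventually_ge_atTop {1}] with F hF
    have : (1 : Γ) ∈ F := hF (Finset.mem_singleton_self 1)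
    simp [hu, this]

lemma finSupp_le_ellp : finSupp (cayley S) p 1 ≤ ellp (cayley S) p (1 : Γ) := fun f hf =>
  summable_of_hasFiniteSupport ((mem_finSupp.1 hf).subset fun x hx h0 => hx (by
    simp [h0, Real.zero_rpow (show p ≠ 0 by linarith [hp.out])]))

lemma topologicalClosure_ellp_sup_constants :
    (ellp (cayley S) p (1 : Γ) ⊔ constants (cayley S) p (1 : Γ)).topologicalClosure =
      closureFinSuppSupConst (cayley S) p 1 := by
  refine le_antisymm (Submodule.topologicalClosure_minimal _
    (sup_le_sup_right ellp_le_closure_finSupp _) isClosed_closureFinSuppSupConst) (sup_le ?_ ?_)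
  · exact Submodule.topologicalClosure_mono (finSupp_le_ellp.trans le_sup_left)
  · exact le_sup_right.trans (Submodule.le_topologicalClosure _)

lemma subsingleton_reducedCohomology_iff : Subsingleton (reducedCohomology S p) ↔
    closureFinSuppSupConst (cayley S) p (1 : Γ) = ⊤ := by
  rw [Submodule.Quotient.subsingleton_iff, topologicalClosure_ellp_sup_constants]

/-- Finite energy puts the differences along generators in ℓ^p; a general x is a word in the
generators. This links ℓ^p with translation invariance. -/
lemma translate_sub_mem_ellp (hS : Subgroup.closure (S : Set Γ) = ⊤) (x : Γ)
    (f : DirichletSpace (cayley S) p (1 : Γ)) :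
    translate p hS x f - f ∈ ellp (cayley S) p (1 : Γ) := by
  have h := shiftSum_lt_top hS (show 0 < p by linarith [hp.out]) f.dirichletSum_lt_top x⁻¹
  have h2 := ENNReal.summable_toReal h.ne
  simp only [ENNReal.toReal_ofReal (Real.rpow_nonneg (abs_nonneg _) _)] at h2
  exact h2

lemma continuous_mkQ_constants :
    Continuous (constants (cayley S) p (1 : Γ)).mkQ := continuous_quot_mk

/-- A functional on `D_p(Γ)` that vanishes on `ℓ^p(Γ)` and on the constants is translation
invariant. -/
lemma isTILF_liftQ (hS : Subgroup.closure (S : Set Γ) = ⊤)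
    (φ : DirichletSpace (cayley S) p (1 : Γ) →ₗ[ℝ] ℝ)
    (h0 : constants (cayley S) p (1 : Γ) ≤ LinearMap.ker φ)
    (h1 : ∀ f ∈ ellp (cayley S) p (1 : Γ), φ f = 0) :
    IsTILF p hS ((constants (cayley S) p (1 : Γ)).liftQ φ h0) := by
  intro x u
  obtain ⟨f, rfl⟩ := Submodule.Quotient.mk_surjective _ u
  change φ (translate p hS x f) = φ f
  rw [← sub_eq_zero, ← map_sub]
  exact h1 _ (translate_sub_mem_ellp hS x f)

/-- Hahn-Banach: a continuous functional separating a point from a proper closed subspace containing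
ℓ^p and the constants is a nonzero TILF. -/
lemma eq_top_of_continuous_TILF (hS : Subgroup.closure (S : Set Γ) = ⊤)
    (h : ∀ T : DirichletModConst (cayley S) p (1 : Γ) →ₗ[ℝ] ℝ,
      Continuous T → IsTILF p hS T → T = 0) :
    closureFinSuppSupConst (cayley S) p (1 : Γ) = ⊤ := by
  by_contra hne
  obtain ⟨f, hf⟩ : ∃ f, f ∉ closureFinSuppSupConst (cayley S) p (1 : Γ) := by
    by_contra hall
    push Not at hall
    exact hne (eq_top_iff.2 fun f _ => hall f)
  obtain ⟨φ, u, hφ, hu⟩ := geometric_hahn_banach_closed_point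
    (closureFinSuppSupConst (cayley S) p (1 : Γ)).convex isClosed_closureFinSuppSupConst hf
  have hu0 : 0 < u := by simpa using hφ 0 (Submodule.zero_mem _)
  -- A functional bounded above by u on a subspace vanishes there: otherwise rescaling g would give
  -- the value u itself, contradicting strict inequality.
  have hφ0 : ∀ g ∈ closureFinSuppSupConst (cayley S) p (1 : Γ), φ g = 0 := by
    intro g hg
    by_contra hg0
    have h1 := hφ ((u / φ g) • g) (Submodule.smul_mem _ _ hg)
    rw [map_smul, smul_eq_mul, div_mul_cancel₀ _ hg0] at h1
    exact lt_irrefl _ h1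
  have hc : constants (cayley S) p (1 : Γ) ≤ LinearMap.ker (φ : _ →ₗ[ℝ] ℝ) := fun g hg =>
    hφ0 g (Submodule.mem_sup_right hg)
  have hT := h ((constants (cayley S) p (1 : Γ)).liftQ (φ : _ →ₗ[ℝ] ℝ) hc)
    (by refine continuous_coinduced_dom.2 ?_; exact φ.continuous)
    (isTILF_liftQ hS _ hc fun g hg =>
      hφ0 g (Submodule.mem_sup_left (ellp_le_closure_finSupp hg)))
  have h2 : φ f = 0 := by
    have := LinearMap.congr_fun hT ((constants (cayley S) p (1 : Γ)).mkQ f)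
    simpa using this
  linarith

open Classical in
/-- The indicator function of the point `x`, as an element of `D_p(Γ)`. -/
def delta (S : Finset Γ) (p : ℝ) [Fact (1 < p)] (x : Γ) : DirichletSpace (cayley S) p (1 : Γ) :=
  mk (Pi.single x 1) (dirichletSum_lt_top_of_finite (finite_support_single x 1))

open Classical in
lemma delta_apply (x y : Γ) : delta S p x y = if y = x then 1 else 0 := by
  change (Pi.single x 1 : Γ → ℝ) y = _
  rw [Pi.single_apply]

lemma sum_smul_delta_apply (F : Finset Γ) (a : Γ → ℝ) (y : Γ) :
    (∑ x ∈ F, a x • delta S p x) y = (F : Set Γ).indicator a y := by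
  classical
  have h : ∀ F : Finset Γ, (∑ x ∈ F, a x • delta S p x) y = ∑ x ∈ F, a x * delta S p x y := by
    intro F
    induction F using Finset.induction_on with
    | empty => rfl
    | insert x F hx ih =>
      rw [Finset.sum_insert hx, Finset.sum_insert hx, DirichletSpace.add_apply, ih,
        DirichletSpace.smul_apply]
  rw [h]
  simp [delta_apply, Set.indicator_apply]

lemma eq_sum_smul_delta {f : DirichletSpace (cayley S) p (1 : Γ)}
    (hf : f ∈ finSupp (cayley S) p 1) :
    f = ∑ x ∈ (mem_finSupp.1 hf).toFinset, f x • delta S p x := by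
  refine DirichletSpace.ext fun y => ?_
  rw [sum_smul_delta_apply, Set.Finite.coe_toFinset, Set.indicator_support]

lemma translate_delta (hS : Subgroup.closure (S : Set Γ) = ⊤) (x : Γ) :
    translate p hS x (delta S p 1) = delta S p x := by
  refine DirichletSpace.ext fun y => ?_
  change delta S p 1 (y * x⁻¹) = _
  classical
  simp only [delta_apply]
  exact if_congr mul_inv_eq_one rfl rfl

/-- Uniform averages of point masses tend to `0` in `D_p(Γ)`. -/
lemma exists_average_tendsto_zero [Infinite Γ] : ∃ F : ℕ → Finset Γ,
    (∀ n, (F n).card = n + 1) ∧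
    Tendsto (fun n => ∑ x ∈ F n, (1 / ((n : ℝ) + 1)) • delta S p x) atTop (𝓝 0) := by
  have hp0 : 0 < p := by linarith [hp.out]
  choose F hF using fun n => Infinite.exists_subset_card_eq Γ (n + 1)
  refine ⟨F, hF, tendsto_iff.2 ⟨?_, ?_⟩⟩
  · obtain ⟨K, hK, h⟩ := exists_dirichletSum_le_tsum S hp0
    -- The p-th power of the ℓ^p-norm of the average is (n + 1)(n + 1)^(-p) = (n + 1)^(-(p - 1));
    -- this tends to 0 exactly because p > 1.
    have hle : ∀ n : ℕ, dirichletSum (cayley S) p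
        (fun y => (∑ x ∈ F n, (1 / ((n : ℝ) + 1)) • delta S p x) y -
          (0 : DirichletSpace (cayley S) p (1 : Γ)) y) ≤
        K * ENNReal.ofReal ((1 / ((n : ℝ) + 1)) ^ (p - 1)) := fun n => by
      have hn : 0 < 1 / ((n : ℝ) + 1) := Nat.one_div_pos_of_nat
      refine (h _).trans (mul_le_mul_right (le_of_eq ?_) K)
      rw [tsum_eq_sum (s := F n)]
      · have h1 : ∀ y ∈ F n, ENNReal.ofReal (|(∑ x ∈ F n, (1 / ((n : ℝ) + 1)) • delta S p x) y -
            (0 : DirichletSpace (cayley S) p (1 : Γ)) y| ^ p) =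
            ENNReal.ofReal ((1 / ((n : ℝ) + 1)) ^ p) := fun y hy => by
          rw [sum_smul_delta_apply (F n) (fun _ => 1 / ((n : ℝ) + 1)) y,
            Set.indicator_of_mem (by exact_mod_cast hy), DirichletSpace.zero_apply, sub_zero,
            abs_of_pos hn]
        rw [Finset.sum_congr rfl h1, Finset.sum_const, hF, nsmul_eq_mul,
          ← ENNReal.ofReal_natCast, ← ENNReal.ofReal_mul (by positivity)]
        congr 1
        rw [Real.rpow_sub_one hn.ne']
        push_cast
        field_simp
      · intro y hy
        rw [sum_smul_delta_apply (F n) (fun _ => 1 / ((n : ℝ) + 1)) y,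
          Set.indicator_of_notMem (by exact_mod_cast hy), DirichletSpace.zero_apply, sub_zero,
          abs_zero, Real.zero_rpow hp0.ne', ENNReal.ofReal_zero]
    have ht : Tendsto (fun n : ℕ => (1 / ((n : ℝ) + 1)) ^ (p - 1)) atTop (𝓝 0) := by
      have := (tendsto_one_div_add_atTop_nhds_zero_nat (𝕜 := ℝ)).rpow_const (p := p - 1)
        (Or.inr (by linarith [hp.out]))
      rwa [Real.zero_rpow (by linarith [hp.out])] at this
    have ht2 := ENNReal.Tendsto.const_mul (a := K)
      ((ENNReal.continuous_ofReal.tendsto 0).comp ht) (Or.inr hK)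
    rw [ENNReal.ofReal_zero, mul_zero] at ht2
    exact tendsto_of_tendsto_of_tendsto_of_le_of_le tendsto_const_nhds ht2 (fun _ => zero_le) hle
  · classical
    refine squeeze_zero_norm (fun n => ?_) (tendsto_one_div_add_atTop_nhds_zero_nat (𝕜 := ℝ))
    have hn : 0 < 1 / ((n : ℝ) + 1) := Nat.one_div_pos_of_nat
    rw [sum_smul_delta_apply (F n) (fun _ => 1 / ((n : ℝ) + 1)), Real.norm_eq_abs,
      Set.indicator_apply]
    split_ifs
    · rw [abs_of_pos hn]
    · rw [abs_zero]; exact hn.le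

/-- Invariance gives T the same value at all point masses, hence at all their averages, which tend
to 0. So T kills point masses, then by continuity the closure of their span. -/
lemma continuous_TILF_eq_zero [Infinite Γ] (hS : Subgroup.closure (S : Set Γ) = ⊤)
    (h : closureFinSuppSupConst (cayley S) p (1 : Γ) = ⊤)
    (T : DirichletModConst (cayley S) p (1 : Γ) →ₗ[ℝ] ℝ) (hT : Continuous T)
    (hinv : IsTILF p hS T) : T = 0 := by
  set φ : DirichletSpace (cayley S) p (1 : Γ) →ₗ[ℝ] ℝ :=
    T.comp (constants (cayley S) p (1 : Γ)).mkQ with hφ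
  have hφc : Continuous φ := hT.comp continuous_mkQ_constants
  have hδ : ∀ x, φ (delta S p x) = φ (delta S p 1) := fun x => by
    rw [← translate_delta hS x]
    exact hinv x ((constants (cayley S) p (1 : Γ)).mkQ (delta S p 1))
  obtain ⟨F, hF, hlim⟩ := exists_average_tendsto_zero (S := S) (p := p)
  have hzero : φ (delta S p 1) = 0 := by
    have h1 := (hφc.tendsto 0).comp hlim
    rw [map_zero] at h1
    refine tendsto_nhds_unique (tendsto_const_nhds.congr fun n => ?_) h1
    have hn : (n : ℝ) + 1 ≠ 0 := by positivity
    simp only [Function.comp_apply, map_sum, map_smul, hδ, Finset.sum_const, hF, nsmul_eq_mul,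
      smul_eq_mul]
    push_cast
    field_simp
  have hker : closureFinSuppSupConst (cayley S) p (1 : Γ) ≤ LinearMap.ker φ := by
    refine sup_le (Submodule.topologicalClosure_minimal _ (fun f hf => ?_) ?_) fun f hf => ?_
    · rw [LinearMap.mem_ker, eq_sum_smul_delta hf, map_sum]
      exact Finset.sum_eq_zero fun x _ => by rw [map_smul, hδ, hzero, smul_zero]
    · exact isClosed_singleton.preimage hφc
    · rw [LinearMap.mem_ker, hφ, LinearMap.comp_apply, Submodule.mkQ_apply,
        (Submodule.Quotient.mk_eq_zero _).2 hf, map_zero]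
  refine LinearMap.ext fun u => ?_
  obtain ⟨f, rfl⟩ := Submodule.Quotient.mk_surjective _ u
  exact hker (h ▸ Submodule.mem_top)

end Cayley

/-! ### The ℓ^p-inequality for nonamenable groups. -/

section Amenable

variable {Γ : Type*} [Group Γ] {S : Finset Γ} {p : ℝ}

/-- A finitely additive probability measure that does not increase under right translations by the
generators and their inverses gives a left invariant one. -/
lemma isAmenable_of_right (hS : Subgroup.closure (S : Set Γ) = ⊤) {m : Set Γ → ℝ≥0∞}
    (h1 : m Set.univ = 1) (hadd : ∀ s t, Disjoint s t → m (s ∪ t) = m s + m t)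
    (hinv : ∀ t ∈ S, ∀ A, m ((· * t) ⁻¹' A) ≤ m A ∧ m ((· * t⁻¹) ⁻¹' A) ≤ m A) :
    IsAmenable Γ := by
  -- The inequality is carried for t and its inverse together, so that it survives inversion;
  -- applying it to both then yields equality.
  have key : ∀ t : Γ, ∀ A, m ((· * t) ⁻¹' A) ≤ m A ∧ m ((· * t⁻¹) ⁻¹' A) ≤ m A := by
    have hcomp : ∀ (t u : Γ) (A : Set Γ),
        (· * (t * u)) ⁻¹' A = (· * t) ⁻¹' ((· * u) ⁻¹' A) := fun t u A => by
      ext x; simp [mul_assoc]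
    intro t
    have ht : t ∈ Subgroup.closure (S : Set Γ) := hS ▸ Subgroup.mem_top t
    induction ht using Subgroup.closure_induction with
    | mem s hs => exact hinv s hs
    | one => intro A; simp
    | mul t u _ _ ht hu =>
      intro A
      refine ⟨?_, ?_⟩
      · rw [hcomp]; exact (ht _).1.trans (hu _).1
      · rw [mul_inv_rev, hcomp]; exact (hu _).2.trans (ht _).2
    | inv t _ ht => intro A; rw [inv_inv]; exact (ht A).symm
  have heq : ∀ (t : Γ) (A : Set Γ), m ((· * t) ⁻¹' A) = m A := fun t A => by
    refine le_antisymm (key t A).1 ?_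
    have h2 := (key t ((· * t) ⁻¹' A)).2
    refine le_trans (le_of_eq (congrArg m ?_)) h2
    ext x; simp
  -- Inversion of sets turns right invariance into left invariance.
  refine ⟨fun A => m A⁻¹, by simpa using h1, fun s t hst => ?_, fun g s => ?_⟩
  · change m (s ∪ t)⁻¹ = m s⁻¹ + m t⁻¹
    rw [Set.union_inv]
    refine hadd _ _ ?_
    rw [Set.disjoint_left] at hst ⊢
    exact fun x hx hx2 => hst hx hx2
  · change m (g • s)⁻¹ = m s⁻¹
    rw [← heq g s⁻¹]
    congr 1
    ext x
    simp [Set.mem_smul_set_iff_inv_smul_mem]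

/-- After the substitution x ↦ x t, |f(x t)|^p and |f(x)|^p are compared on A. The two totals of
|f|^p coincide, so the error η/2 is counted twice. -/
lemma tsum_indicator_translate_le (hp : 0 < p) {η : ℝ} (hη : 0 < η) : ∃ C : ℝ≥0∞, C ≠ ∞ ∧
    ∀ (f : Γ → ℝ) (t : Γ) (A : Set Γ),
      ∑' x, ((· * t⁻¹) ⁻¹' A).indicator (fun x => ENNReal.ofReal (|f x| ^ p)) x ≤
        ∑' x, A.indicator (fun x => ENNReal.ofReal (|f x| ^ p)) x +
          ENNReal.ofReal η * ∑' x, ENNReal.ofReal (|f x| ^ p) + C * shiftSum p f t := by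
  obtain ⟨C, hC, h⟩ := exists_abs_rpow_sub_rpow_le hp (half_pos hη)
  refine ⟨ENNReal.ofReal C, ENNReal.ofReal_ne_top, fun f t A => ?_⟩
  rw [← (Equiv.mulRight t).tsum_eq]
  have hinv : ∑' x, ENNReal.ofReal (|f (x * t)| ^ p) = ∑' x, ENNReal.ofReal (|f x| ^ p) :=
    (Equiv.mulRight t).tsum_eq fun x => ENNReal.ofReal (|f x| ^ p)
  have hle : ∀ x, ((· * t⁻¹) ⁻¹' A).indicator (fun x => ENNReal.ofReal (|f x| ^ p))
      (Equiv.mulRight t x) ≤ A.indicator (fun x => ENNReal.ofReal (|f x| ^ p)) x +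
        (ENNReal.ofReal (η / 2) * (ENNReal.ofReal (|f (x * t)| ^ p) +
          ENNReal.ofReal (|f x| ^ p)) +
        ENNReal.ofReal C * ENNReal.ofReal (|f (x * t) - f x| ^ p)) := fun x => by
    by_cases hx : x ∈ A
    · have hx2 : Equiv.mulRight t x ∈ ((· * t⁻¹) ⁻¹' A) := by simpa using hx
      rw [Set.indicator_of_mem hx, Set.indicator_of_mem hx2,
        ← ENNReal.ofReal_add (by positivity) (by positivity),
        ← ENNReal.ofReal_mul (by positivity), ← ENNReal.ofReal_mul (by positivity),
        ← ENNReal.ofReal_add (by positivity) (by positivity),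
        ← ENNReal.ofReal_add (by positivity) (by positivity)]
      refine ENNReal.ofReal_le_ofReal ?_
      have h1 := (le_abs_self _).trans (h (f (x * t)) (f x))
      rw [Equiv.coe_mulRight]
      linarith
    · have hx2 : Equiv.mulRight t x ∉ ((· * t⁻¹) ⁻¹' A) := by simpa using hx
      rw [Set.indicator_of_notMem hx2]
      exact zero_le
  refine (ENNReal.tsum_le_tsum hle).trans (le_of_eq ?_)
  rw [ENNReal.tsum_add, ENNReal.tsum_add, ENNReal.tsum_mul_left, ENNReal.tsum_mul_left,
    ENNReal.tsum_add, hinv, ← two_mul, ← mul_assoc, ← add_assoc]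
  congr 3
  rw [← ENNReal.ofReal_ofNat 2, ← ENNReal.ofReal_mul (by positivity)]
  congr 1
  ring

/-- If `Γ` is not amenable, the `ℓ^p`-norm of a finitely supported function is controlled by its
differences along the generators. -/
lemma exists_tsum_le_sum_shiftSum (hS : Subgroup.closure (S : Set Γ) = ⊤)
    (hΓ : ¬ IsAmenable Γ) (hp : 0 < p) : ∃ C : ℝ≥0∞, C ≠ ∞ ∧
    ∀ f : Γ → ℝ, (Function.support f).Finite →
      ∑' x, ENNReal.ofReal (|f x| ^ p) ≤ C * ∑ s ∈ S, shiftSum p f s := by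
  by_contra hcon
  push Not at hcon
  -- A counterexample for each constant n + 1: the differences of f_n are less than 1/(n + 1) of its
  -- total mass.
  choose f hfs hf using fun n : ℕ => hcon (n + 1) (by finiteness)
  set a : ℕ → ℝ≥0∞ := fun n => ∑' x, ENNReal.ofReal (|f n x| ^ p) with ha
  have ha0 : ∀ n, a n ≠ 0 := fun n => (zero_le.trans_lt (hf n)).ne'
  have hat : ∀ n, a n ≠ ∞ := fun n => Summable.tsum_ofReal_ne_top
    (summable_of_hasFiniteSupport ((hfs n).subset fun x hx h0 => hx (by
      simp [h0, Real.zero_rpow hp.ne'])))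
  set μ : ℕ → Set Γ → ℝ≥0∞ := fun n A =>
    (∑' x, A.indicator (fun x => ENNReal.ofReal (|f n x| ^ p)) x) / a n with hμ
  set U : Ultrafilter ℕ := hyperfilter ℕ
  have hUle : (U : Filter ℕ) ≤ atTop := by
    rw [← Nat.cofinite_eq_atTop]; exact hyperfilter_le_cofinite
  -- The limit exists because [0, ∞] is compact.
  set m : Set Γ → ℝ≥0∞ := fun A => (U.map fun n => μ n A).lim with hm
  have hlim : ∀ A, Tendsto (fun n => μ n A) U (𝓝 (m A)) := fun A =>
    (U.map fun n => μ n A).le_nhds_lim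
  -- After division by the total mass the translation error is at most η + C/(n + 1), with C
  -- independent of n; the limit in n leaves η, which is arbitrary.
  have hshift : ∀ t : Γ, (∀ n, shiftSum p (f n) t ≤ ∑ s ∈ S, shiftSum p (f n) s) →
      ∀ A, m ((· * t⁻¹) ⁻¹' A) ≤ m A := by
    intro t ht A
    refine ENNReal.le_of_forall_pos_le_add fun η hη _ => ?_
    obtain ⟨C, hC, h⟩ := tsum_indicator_translate_le (Γ := Γ) hp
      (show (0 : ℝ) < η by exact_mod_cast hη)
    have hle : ∀ n : ℕ, μ n ((· * t⁻¹) ⁻¹' A) ≤ μ n A + η + C * ((n : ℝ≥0∞) + 1)⁻¹ := fun n => by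
      have h1 := ENNReal.div_le_div_right (h (f n) t A) (a n)
      refine h1.trans ?_
      rw [ENNReal.add_div, ENNReal.add_div, mul_div_assoc, mul_div_assoc,
        ENNReal.div_self (ha0 n) (hat n), mul_one, ENNReal.ofReal_coe_nnreal]
      gcongr
      rw [ENNReal.div_le_iff (ha0 n) (hat n), mul_comm, ← div_eq_mul_inv,
        ENNReal.le_div_iff_mul_le (Or.inl (by simp)) (Or.inl (by finiteness)), mul_comm]
      exact (mul_le_mul_right (ht n) _).trans (hf n).le
    have h0 : Tendsto (fun n : ℕ => C * ((n : ℝ≥0∞) + 1)⁻¹) U (𝓝 0) := by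
      have h2 : Tendsto (fun n : ℕ => ((n : ℝ≥0∞) + 1)⁻¹) atTop (𝓝 0) := by
        have := (tendsto_add_atTop_iff_nat 1).2 ENNReal.tendsto_inv_nat_nhds_zero
        simpa using this
      have h3 := ENNReal.Tendsto.const_mul (a := C) (h2.mono_left hUle) (Or.inr hC)
      rwa [mul_zero] at h3
    have h4 := ((hlim A).add_const (η : ℝ≥0∞)).add h0
    rw [add_zero] at h4
    exact le_of_tendsto_of_tendsto' (hlim _) h4 hle
  refine hΓ (isAmenable_of_right hS (m := m) ?_ (fun s t hst => ?_) fun t ht A => ⟨?_, ?_⟩)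
  · refine tendsto_nhds_unique (hlim _) (tendsto_const_nhds.congr fun n => ?_)
    simp only [hμ, Set.indicator_univ]
    exact (ENNReal.div_self (ha0 n) (hat n)).symm
  · refine tendsto_nhds_unique (hlim _) (((hlim s).add (hlim t)).congr fun n => ?_)
    simp only [hμ]
    rw [← ENNReal.add_div, ← ENNReal.tsum_add, Set.indicator_union_of_disjoint hst]
  · have h1 := hshift t⁻¹ (fun n => by
      rw [shiftSum_inv]
      exact Finset.single_le_sum (f := fun s => shiftSum p (f n) s) (fun _ _ => zero_le) ht) A
    rwa [inv_inv] at h1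
  · exact hshift t (fun n =>
      Finset.single_le_sum (f := fun s => shiftSum p (f n) s) (fun _ _ => zero_le) ht) A

/-- Approximants have bounded energy, so the inequality bounds their ℓ^p-norms uniformly, and Fatou
passes the bound to the limit. -/
lemma closure_finSupp_le_ellp [hp : Fact (1 < p)] (hS : Subgroup.closure (S : Set Γ) = ⊤)
    (hΓ : ¬ IsAmenable Γ) :
    (finSupp (cayley S) p 1).topologicalClosure ≤ ellp (cayley S) p (1 : Γ) := by
  classical
  intro f hf
  have hp0 : 0 < p := by linarith [hp.out]
  rw [← SetLike.mem_coe, Submodule.topologicalClosure_coe, mem_closure_iff_seq_limit] at hf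
  obtain ⟨u, hu, hlim⟩ := hf
  obtain ⟨C, hC, h⟩ := exists_tsum_le_sum_shiftSum hS hΓ hp0
  set B : ℝ := (dirichletSum (cayley S) p f).toReal + 1
  have hev : ∀ᶠ n in atTop, dirichletSum (cayley S) p (u n) ≤ ENNReal.ofReal B := by
    have h1 := (continuous_toReal_dirichletSum.tendsto f).comp hlim
    filter_upwards [h1.eventually (gt_mem_nhds (lt_add_one _))] with n hn
    exact (ENNReal.le_ofReal_iff_toReal_le (u n).dirichletSum_lt_top.ne (by positivity)).2 hn.le
  have hbound : ∀ᶠ n in atTop, ∑' x, ENNReal.ofReal (|u n x| ^ p) ≤ C * ENNReal.ofReal B := by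
    filter_upwards [hev] with n hn
    refine (h _ (hu n)).trans (mul_le_mul_right (le_trans ?_ hn) C)
    rw [dirichletSum_eq_sum_shiftSum S hp0.ne']
    exact Finset.sum_le_sum_of_subset Finset.subset_union_left
  have hfin : ∑' x, ENNReal.ofReal (|f x| ^ p) ≤ C * ENNReal.ofReal B := by
    rw [ENNReal.tsum_eq_iSup_sum]
    refine iSup_le fun F => ?_
    have ht : Tendsto (fun n => ∑ x ∈ F, ENNReal.ofReal (|u n x| ^ p)) atTop
        (𝓝 (∑ x ∈ F, ENNReal.ofReal (|f x| ^ p))) :=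
      tendsto_finsetSum _ fun x _ => (ENNReal.continuous_ofReal.tendsto _).comp
        ((tendsto_apply (cayley_preconnected hS) hlim x).abs.rpow_const (Or.inr hp0.le))
    exact le_of_tendsto ht (hbound.mono fun n hn => (ENNReal.sum_le_tsum F).trans hn)
  have h2 := ENNReal.summable_toReal
    (hfin.trans_lt (ENNReal.mul_lt_top hC.lt_top ENNReal.ofReal_lt_top)).ne
  simp only [ENNReal.toReal_ofReal (Real.rpow_nonneg (abs_nonneg _) _)] at h2
  exact h2

end Amenable

/-! ### Duality between ℓ^p and ℓ^q on finitely supported functions. -/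

section Duality

lemma summable_finsupp_rpow {ι : Type*} {q : ℝ} (hq : q ≠ 0) (F : ι →₀ ℝ) :
    Summable fun i => |F i| ^ q :=
  have hF : (Function.support F).Finite := F.hasFiniteSupport
  summable_of_hasFiniteSupport (hF.subset fun i hi h0 => hi (by simp [h0, Real.zero_rpow hq]))

/-- The `ℓ^q`-norm of a finitely supported function. -/
def finsuppNorm {ι : Type*} (q : ℝ) (F : ι →₀ ℝ) : ℝ := (∑' i, |F i| ^ q) ^ (1 / q)

/-- A functional on the finitely supported functions that is bounded in the `ℓ^q`-norm is given by
an `ℓ^p`-function, where `p` is the conjugate exponent. -/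
lemma summable_of_le_finsuppNorm {ι : Type*} {p q : ℝ} (hpq : p.HolderConjugate q)
    (Φ : (ι →₀ ℝ) →ₗ[ℝ] ℝ) {K : ℝ} (hK : 0 ≤ K) (hΦ : ∀ F, Φ F ≤ K * finsuppNorm q F) :
    Summable fun i => |Φ (Finsupp.single i 1)| ^ p := by
  classical
  set a : ι → ℝ := fun i => Φ (Finsupp.single i 1) with ha
  have hp0 : 0 < p := hpq.pos
  have hq0 : 0 < q := hpq.symm.pos
  refine summable_of_sum_le (c := K ^ p) (fun i => by positivity) fun A => ?_
  set X : ℝ := ∑ i ∈ A, |a i| ^ p with hX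
  have hX0 : 0 ≤ X := Finset.sum_nonneg fun i _ => by positivity
  -- The extremal function in Hölder's inequality: Φ F and the sum of |F|^q both equal X, so X ≤ K
  -- X^(1/q), that is, X^(1/p) ≤ K.
  set F : ι →₀ ℝ := ∑ i ∈ A, Finsupp.single i (|a i| ^ (p - 2) * a i) with hF
  have hFi : ∀ i, F i = if i ∈ A then |a i| ^ (p - 2) * a i else 0 := fun i => by
    rw [hF, Finsupp.finsetSum_apply]
    simp [Finsupp.single_apply]
  have hΦF : Φ F = X := by
    rw [hF, map_sum, hX]
    refine Finset.sum_congr rfl fun i _ => ?_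
    have h1 : Finsupp.single i (|a i| ^ (p - 2) * a i) =
        (|a i| ^ (p - 2) * a i) • Finsupp.single i (1 : ℝ) := by simp
    rw [h1, map_smul, smul_eq_mul]
    change |a i| ^ (p - 2) * a i * a i = |a i| ^ p
    by_cases h0 : a i = 0
    · simp [h0, Real.zero_rpow hp0.ne']
    · have h2 : 0 < |a i| := abs_pos.2 h0
      rw [mul_assoc, ← abs_mul_abs_self, ← sq, ← Real.rpow_natCast, ← Real.rpow_add h2]
      congr 1; push_cast; ring
  have hnorm : ∑' i, |F i| ^ q = X := by
    rw [tsum_eq_sum (s := A) fun i hi => by rw [hFi, if_neg hi, abs_zero, Real.zero_rpow hq0.ne'],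
      hX]
    refine Finset.sum_congr rfl fun i hi => ?_
    rw [hFi, if_pos hi]
    by_cases h0 : a i = 0
    · simp [h0, Real.zero_rpow hp0.ne', Real.zero_rpow hq0.ne']
    · have h2 : 0 < |a i| := abs_pos.2 h0
      rw [abs_mul, abs_of_pos (Real.rpow_pos_of_pos h2 _)]
      nth_rewrite 2 [← Real.rpow_one |a i|]
      rw [← Real.rpow_add h2, ← Real.rpow_mul h2.le]
      congr 1
      have := hpq.sub_one_mul_conj
      linarith
  have h1 := hΦ F
  rw [hΦF, finsuppNorm, hnorm] at h1
  rcases hX0.eq_or_lt with h0 | h0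
  · rw [← h0]; positivity
  · have h2 : X ^ (1 / p) ≤ K := by
      have h3 : X = X ^ (1 / p) * X ^ (1 / q) := by
        rw [← Real.rpow_add h0, one_div, one_div, hpq.inv_add_inv_eq_one, Real.rpow_one]
      have h4 : 0 < X ^ (1 / q) := Real.rpow_pos_of_pos h0 _
      refine le_of_mul_le_mul_right ?_ h4
      rwa [← h3]
    calc X = (X ^ (1 / p)) ^ p := by
          rw [← Real.rpow_mul hX0, one_div_mul_cancel hp0.ne', Real.rpow_one]
      _ ≤ K ^ p := Real.rpow_le_rpow (by positivity) h2 hp0.le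

lemma finsuppNorm_smul {ι : Type*} {q : ℝ} (hq : 0 < q) {c : ℝ} (hc : 0 < c) (F : ι →₀ ℝ) :
    finsuppNorm q (c • F) = c * finsuppNorm q F := by
  unfold finsuppNorm
  have h : ∀ i, |(c • F) i| ^ q = c ^ q * |F i| ^ q := fun i => by
    rw [Finsupp.smul_apply, smul_eq_mul, abs_mul, abs_of_pos hc,
      Real.mul_rpow hc.le (abs_nonneg _)]
  rw [tsum_congr h, tsum_mul_left, Real.mul_rpow (by positivity)
    (tsum_nonneg fun i => by positivity), ← Real.rpow_mul hc.le, mul_one_div_cancel hq.ne',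
    Real.rpow_one]

lemma finsuppNorm_add {ι : Type*} {q : ℝ} (hq : 1 ≤ q) (F H : ι →₀ ℝ) :
    finsuppNorm q (F + H) ≤ finsuppNorm q F + finsuppNorm q H := by
  have hq0 : 0 < q := by linarith
  have h := Real.Lp_add_le_tsum_of_nonneg hq (fun i => abs_nonneg (F i))
    (fun i => abs_nonneg (H i)) (summable_finsupp_rpow hq0.ne' F) (summable_finsupp_rpow hq0.ne' H)
  refine le_trans ?_ h.2
  refine Real.rpow_le_rpow (tsum_nonneg fun i => by positivity) ?_ (by positivity)
  exact (summable_finsupp_rpow hq0.ne' _).tsum_le_tsum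
    (fun i => Real.rpow_le_rpow (abs_nonneg _) (abs_add_le _ _) hq0.le) h.1

/-- A linear map between spaces of finitely supported functions that is bounded below in the
`ℓ^q`-norms has a surjective transpose on `ℓ^p`. -/
lemma exists_transpose_eq {α ι : Type*} {p q : ℝ} (hpq : p.HolderConjugate q)
    (D : (α →₀ ℝ) →ₗ[ℝ] (ι →₀ ℝ)) {K : ℝ} (hK : 0 ≤ K)
    (hD : ∀ f, finsuppNorm q f ≤ K * finsuppNorm q (D f)) {g : α → ℝ}
    (hg : Summable fun x => |g x| ^ p) :
    ∃ Φ : (ι →₀ ℝ) →ₗ[ℝ] ℝ, (Summable fun i => |Φ (Finsupp.single i 1)| ^ p) ∧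
      ∀ x, Φ (D (Finsupp.single x 1)) = g x := by
  have hp0 : 0 < p := hpq.pos
  have hq0 : 0 < q := hpq.symm.pos
  have hinj : Function.Injective D := by
    rw [injective_iff_map_eq_zero]
    intro f hf
    have h1 := hD f
    have hz : finsuppNorm q (0 : ι →₀ ℝ) = 0 := by
      simp [finsuppNorm, Real.zero_rpow hq0.ne', hq0.ne']
    rw [hf, hz, mul_zero] at h1
    have hn : 0 ≤ ∑' i, |f i| ^ q := tsum_nonneg fun i => by positivity
    have h2 : ∑' i, |f i| ^ q = 0 := by
      by_contra hne
      exact absurd h1 (not_le.2 (Real.rpow_pos_of_pos (lt_of_le_of_ne hn (Ne.symm hne)) _))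
    ext i
    have h3 := (summable_finsupp_rpow hq0.ne' f).le_tsum i fun j _ => by positivity
    rw [h2] at h3
    have h4 := (Real.rpow_eq_zero (abs_nonneg _) hq0.ne').1 (le_antisymm h3 (by positivity))
    simpa using h4
  set lam : (α →₀ ℝ) →ₗ[ℝ] ℝ := Finsupp.linearCombination ℝ g with hlam
  set N : ℝ := (∑' x, |g x| ^ p) ^ (1 / p) with hN
  have hN0 : 0 ≤ N := Real.rpow_nonneg (tsum_nonneg fun i => by positivity) _
  have hlamle : ∀ f, lam f ≤ N * finsuppNorm q f := fun f => by
    rw [hlam, Finsupp.linearCombination_apply, Finsupp.sum]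
    have h1 := Real.inner_le_Lp_mul_Lq f.support g f hpq
    have h2 : (∑ i ∈ f.support, |g i| ^ p) ^ (1 / p) ≤ N :=
      Real.rpow_le_rpow (Finset.sum_nonneg fun i _ => by positivity)
        (hg.sum_le_tsum _ fun i _ => by positivity) (by positivity)
    have h3 : (∑ i ∈ f.support, |f i| ^ q) ^ (1 / q) = finsuppNorm q f := by
      rw [finsuppNorm, tsum_eq_sum (s := f.support)]
      intro i hi
      rw [Finsupp.notMem_support_iff.1 hi, abs_zero, Real.zero_rpow hq0.ne']
    rw [h3] at h1
    have hnn : 0 ≤ finsuppNorm q f := Real.rpow_nonneg (tsum_nonneg fun i => by positivity) _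
    calc _ = ∑ i ∈ f.support, g i * f i := Finset.sum_congr rfl fun i _ => by
          rw [smul_eq_mul, mul_comm]
      _ ≤ _ := h1
      _ ≤ _ := mul_le_mul_of_nonneg_right h2 hnn
  -- Since D is injective, pairing with g transfers to the range of D, where it is bounded by N K
  -- times the ℓ^q-norm; Hahn-Banach extends it with the same bound.
  set e := LinearEquiv.ofInjective D hinj with he
  obtain ⟨Φ, hΦ1, hΦ2⟩ := exists_extension_of_le_sublinear
    { domain := LinearMap.range D, toFun := lam.comp e.symm.toLinearMap : (ι →₀ ℝ) →ₗ.[ℝ] ℝ }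
    (fun F => (N * K) * finsuppNorm q F)
    (fun c hc F => by rw [finsuppNorm_smul hq0 hc]; ring)
    (fun F H => by
      rw [← mul_add]
      exact mul_le_mul_of_nonneg_left (finsuppNorm_add hpq.symm.lt.le F H) (by positivity))
    (by
      rintro ⟨_, f, rfl⟩
      have h1 : e.symm ⟨D f, f, rfl⟩ = f := by
        rw [LinearEquiv.symm_apply_eq]; rfl
      change lam (e.symm ⟨D f, f, rfl⟩) ≤ _
      rw [h1, mul_assoc]
      exact (hlamle f).trans (mul_le_mul_of_nonneg_left (hD f) hN0))
  refine ⟨Φ, summable_of_le_finsuppNorm hpq Φ (by positivity) hΦ2, fun x => ?_⟩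
  have h1 := hΦ1 ⟨D (Finsupp.single x 1), _, rfl⟩
  have h2 : e.symm ⟨D (Finsupp.single x 1), _, rfl⟩ = Finsupp.single x 1 := by
    rw [LinearEquiv.symm_apply_eq]; rfl
  change _ = lam (e.symm ⟨D (Finsupp.single x 1), _, rfl⟩) at h1
  rw [h2, hlam, Finsupp.linearCombination_single, one_smul] at h1
  exact h1

end Duality

/-! ### Arbitrary TILFs on nonamenable groups. -/

section Nonamenable

variable {Γ : Type*} [Group Γ] {S : Finset Γ} {p : ℝ}

/-- The differences of a finitely supported function along the generators. -/
def diffMap (S : Finset Γ) : (Γ →₀ ℝ) →ₗ[ℝ] (S × Γ →₀ ℝ) :=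
  Finsupp.linearCombination ℝ fun x => ∑ s : S,
    (Finsupp.single (s, x * (s : Γ)⁻¹) (1 : ℝ) - Finsupp.single (s, x) 1)

lemma diffMap_single (x : Γ) : diffMap S (Finsupp.single x 1) = ∑ s : S,
    (Finsupp.single (s, x * (s : Γ)⁻¹) (1 : ℝ) - Finsupp.single (s, x) 1) := by
  rw [diffMap, Finsupp.linearCombination_single, one_smul]

/-- The inverse in the definition makes the coordinates the right differences f(y s) - f(y), while
the transpose produces h_s(x s⁻¹) - h_s(x), a translate minus the function. -/
lemma diffMap_apply (f : Γ →₀ ℝ) (i : S × Γ) : diffMap S f i = f (i.2 * i.1) - f i.2 := by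
  classical
  obtain ⟨s, y⟩ := i
  induction f using Finsupp.induction_linear with
  | zero => simp
  | add f g hf hg => rw [map_add, Finsupp.add_apply, hf, hg, Finsupp.add_apply, Finsupp.add_apply]; ring
  | single x c =>
    have h : Finsupp.single x c = c • Finsupp.single x (1 : ℝ) := by simp
    rw [h, map_smul, diffMap_single, Finsupp.smul_apply, Finsupp.finsetSum_apply,
      Finset.sum_eq_single s]
    · simp only [Finsupp.sub_apply, Finsupp.single_apply, Finsupp.smul_apply, Prod.mk.injEq,
        true_and, smul_eq_mul, mul_inv_eq_iff_eq_mul]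
      ring
    · intro t _ hts
      simp [hts]
    · simp

/-- The shift sums over the generators together form the p-th power of the norm of the difference
map; it remains to take roots. -/
lemma exists_finsuppNorm_le (hS : Subgroup.closure (S : Set Γ) = ⊤) (hΓ : ¬ IsAmenable Γ)
    (hp : 0 < p) : ∃ K : ℝ, 0 ≤ K ∧
      ∀ f : Γ →₀ ℝ, finsuppNorm p f ≤ K * finsuppNorm p (diffMap S f) := by
  obtain ⟨C, hC, h⟩ := exists_tsum_le_sum_shiftSum hS hΓ hp
  refine ⟨C.toReal ^ (1 / p), by positivity, fun f => ?_⟩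
  have hsum : ∑ s ∈ S, shiftSum p f s = ∑' i, ENNReal.ofReal (|diffMap S f i| ^ p) := by
    rw [ENNReal.summable.tsum_prod' (fun _ => ENNReal.summable), tsum_fintype,
      ← Finset.sum_coe_sort S]
    simp only [diffMap_apply, shiftSum]
  have h1 := h f f.hasFiniteSupport
  have hn1 : 0 ≤ ∑' i, |f i| ^ p := tsum_nonneg fun i => by positivity
  have hn2 : 0 ≤ ∑' i, |diffMap S f i| ^ p := tsum_nonneg fun i => by positivity
  have hof1 : ∑' i, ENNReal.ofReal (|f i| ^ p) = ENNReal.ofReal (∑' i, |f i| ^ p) :=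
    (ENNReal.ofReal_tsum_of_nonneg (fun i => by positivity) (summable_finsupp_rpow hp.ne' f)).symm
  rw [hsum, ← ENNReal.ofReal_tsum_of_nonneg (fun i => by positivity)
    (summable_finsupp_rpow hp.ne' (diffMap S f)), hof1, ← ENNReal.ofReal_toReal hC,
    ← ENNReal.ofReal_mul ENNReal.toReal_nonneg, ENNReal.ofReal_le_ofReal_iff (by positivity)] at h1
  unfold finsuppNorm
  rw [← Real.mul_rpow ENNReal.toReal_nonneg hn2]
  exact Real.rpow_le_rpow hn1 h1 (by positivity)

variable [hp : Fact (1 < p)]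

/-- If `Γ` is not amenable, every `ℓ^p`-function is a sum of differences `h_s - h` of a translate
and the function itself. -/
lemma exists_eq_sum_translate_sub (hS : Subgroup.closure (S : Set Γ) = ⊤) (hΓ : ¬ IsAmenable Γ)
    {g : DirichletSpace (cayley S) p (1 : Γ)} (hg : g ∈ ellp (cayley S) p (1 : Γ)) :
    ∃ h : S → DirichletSpace (cayley S) p (1 : Γ),
      g = ∑ s : S, (translate p hS s (h s) - h s) := by
  have hpq := Real.HolderConjugate.conjExponent hp.out
  -- The inequality is used at the conjugate exponent q, so that its dual concerns ℓ^p.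
  obtain ⟨K, hK, hD⟩ := exists_finsuppNorm_le hS hΓ hpq.symm.pos
  obtain ⟨Φ, hΦ, hΦg⟩ := exists_transpose_eq hpq (diffMap S) hK hD hg
  have hs : ∀ s : S, Summable fun y => |Φ (Finsupp.single (s, y) 1)| ^ p := fun s =>
    hΦ.comp_injective (i := fun y => (s, y)) fun a b hab => (Prod.mk.inj hab).2
  set h : S → DirichletSpace (cayley S) p (1 : Γ) := fun s =>
    mk (fun y => Φ (Finsupp.single (s, y) 1))
      (dirichletSum_lt_top_of_summable (by linarith [hp.out]) (hs s)) with hh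
  refine ⟨h, DirichletSpace.ext fun x => ?_⟩
  have hev : ∀ (A : Finset S) (u : S → DirichletSpace (cayley S) p (1 : Γ)),
      (∑ s ∈ A, u s) x = ∑ s ∈ A, u s x := by
    classical
    intro A u
    induction A using Finset.induction_on with
    | empty => rfl
    | insert s A hs ih =>
      rw [Finset.sum_insert hs, Finset.sum_insert hs, DirichletSpace.add_apply, ih]
  rw [hev, ← hΦg x, diffMap_single, map_sum]
  refine Finset.sum_congr rfl fun s _ => ?_
  rw [map_sub]
  rfl

/-- No continuity is needed: modulo constants f lies in the closure of the finitely supported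
functions, hence in ℓ^p, hence is a finite sum of differences h_s - h. -/
lemma TILF_eq_zero (hS : Subgroup.closure (S : Set Γ) = ⊤) (hΓ : ¬ IsAmenable Γ)
    (h : closureFinSuppSupConst (cayley S) p (1 : Γ) = ⊤)
    (T : DirichletModConst (cayley S) p (1 : Γ) →ₗ[ℝ] ℝ) (hT : IsTILF p hS T) : T = 0 := by
  refine LinearMap.ext fun u => ?_
  obtain ⟨f, rfl⟩ := Submodule.Quotient.mk_surjective _ u
  have hf : f ∈ closureFinSuppSupConst (cayley S) p (1 : Γ) := h ▸ Submodule.mem_top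
  obtain ⟨g, hg, c, hc, rfl⟩ := Submodule.mem_sup.1 hf
  obtain ⟨k, hk⟩ := exists_eq_sum_translate_sub hS hΓ (closure_finSupp_le_ellp hS hΓ hg)
  change (T.comp (constants (cayley S) p (1 : Γ)).mkQ) (g + c) = 0
  have hc0 : (T.comp (constants (cayley S) p (1 : Γ)).mkQ) c = 0 := by
    rw [LinearMap.comp_apply, Submodule.mkQ_apply, (Submodule.Quotient.mk_eq_zero _).2 hc,
      map_zero]
  rw [map_add, hc0, add_zero, hk, map_sum]
  refine Finset.sum_eq_zero fun s _ => ?_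
  rw [map_sub, sub_eq_zero]
  exact hT s ((constants (cayley S) p (1 : Γ)).mkQ (k s))

end Nonamenable

end PHarm

end

theorem mainTheorem9 {Γ : Type*} [Group Γ] [Infinite Γ] (S : Finset Γ)
    (hS : Subgroup.closure (S : Set Γ) = ⊤) (p : ℝ) [Fact (1 < p)] :
    List.TFAE [
      Subsingleton (PHarm.reducedCohomology S p),
      PHarm.harmonicBoundary (PHarm.cayley S) p (1 : Γ) = ∅ ∨
        (PHarm.harmonicBoundary (PHarm.cayley S) p (1 : Γ)).ncard = 1,
      PHarm.HD (PHarm.cayley S) p = PHarm.constFun Γ,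
      PHarm.BHD (PHarm.cayley S) p = PHarm.constFun Γ,
      ∀ T : PHarm.DirichletModConst (PHarm.cayley S) p (1 : Γ) →ₗ[ℝ] ℝ,
        Continuous T → PHarm.IsTILF p hS T → T = 0] ∧
    (¬ PHarm.IsAmenable Γ →
      (Subsingleton (PHarm.reducedCohomology S p) ↔
        ∀ T : PHarm.DirichletModConst (PHarm.cayley S) p (1 : Γ) →ₗ[ℝ] ℝ,
          PHarm.IsTILF p hS T → T = 0)) := by
  have hG := PHarm.cayley_preconnected hS
  rw [PHarm.subsingleton_reducedCohomology_iff]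
  -- Nonamenability serves only the direct implication; for the converse, if all TILFs vanish then
  -- the continuous ones do.
  refine ⟨?_, fun hΓ => ⟨fun h T hT => PHarm.TILF_eq_zero hS hΓ h T hT, fun h =>
    PHarm.eq_top_of_continuous_TILF hS fun T _ hT => h T hT⟩⟩
  tfae_have 1 → 2 := PHarm.harmonicBoundary_of_eq_top
  tfae_have 2 → 1 := PHarm.eq_top_of_harmonicBoundary hG
  tfae_have 1 → 3 := PHarm.HD_eq_constFun hG
  tfae_have 3 → 4 := fun h => Set.Subset.antisymm (fun f hf => h ▸ hf.1) PHarm.constFun_subset_BHD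
  tfae_have 4 → 1 := PHarm.closureFinSuppSupConst_eq_top_of_BHD
  tfae_have 1 → 5 := fun h T hT hinv => PHarm.continuous_TILF_eq_zero hS h T hT hinv
  tfae_have 5 → 1 := PHarm.eq_top_of_continuous_TILF hS
  tfae_finish
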